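/- Let $R$ be a commutative ring. **Biset functors.** For finite categories $\mathcal C,\mathcal D$, a $(\mathcal C,\mathcal D)$-biset is a functor $\Omega$ from $\mathcal C\times\mathcal D^{\mathrm{op}}$ to finite sets. It is *birepresentable* if the left $\mathcal C$-set $x\mapsto\bigsqcup_{y}\Omega(x,y)$ is isomorphic to a disjoint union of functors $\mathrm{Hom}_{\mathcal C}(c,-)$ and the right $\mathcal D$-set $y\mapsto\bigsqcup_x\Omega(x,y)$ is isomorphic to a disjoint union of functors $\mathrm{Hom}_{\mathcal D}(-,d)$. The composite of a $(\mathcal C,\mathcal D)$-biset $\Omega$ and a $(\mathcal D,\mathcal E)$-biset $\Psi$ is $(\Omega\circ\Psi)(x,z)=\bigl(\bigsqcup_y\Omega(x,y)\times\Psi(y,z)\bigr)/\!\sim$, where $\sim$ is the equivalence relation generated by $(u\beta,v)\sim(u,\beta v)$ for morphisms $\beta$ of $\mathcal D$. Let $\mathbb B^{1,1}$ be the $R$-linear category whose objects are the finite categories, where $\mathrm{Hom}(\mathcal C,\mathcal D)=R\otimes_{\mathbb Z}A^{1,1}(\mathcal D,\mathcal C)$ with $A^{1,1}(\mathcal D,\mathcal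 C)$ the Grothendieck group of birepresentable $(\mathcal D,\mathcal C)$-bisets with respect to disjoint union, and where composition is induced by $\circ$. A *biset functor* on $\mathbb B^{1,1}$, or on a full subcategory, is an $R$-linear functor from it to $R$-modules. For a finite set $X$ let $2^X$ be the poset of subsets of $X$, regarded as a category. **Correspondence functors.** Let $\mathrm{Corresp}$ be the category whose objects are the finite sets, whose morphisms $X\to Y$ are the subsets $U\subseteq Y\times X$, with composition $UV=\{(z,x)\mid \exists y,\ (z,y)\in U,\ (y,x)\in V\}$. A *correspondence functor* is a functor from $\mathrm{Corresp}$ to $R$-modules. There is a functor $\mathrm{Corresp}\to\mathbb B^{1,1}$ that sends $X$ to $2^X$ and $U\subseteq Y\times X$ to the $(2^Y,2^X)$-biset $(B,A)\mapsto\mathrm{Hom}_{2^Y}({}^+U(A),B)$, where ${}^+U(A)=\{y\mid\exists x\in A,\ (y,x)\in U\}$. For a biset functor $S$, let $\hat S$ be the correspondence functor obtained by composing with this functor. A functor to $R$-modules is *simple* if it is nonzero and has no subfunctors other than zero and itself. A *composition factor* of a functor $F$ is a simple functor isomorphic to $N/M$ for some subfunctors $M\subseteq N\subseteq F$. **Statement.**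 Let $S$ be a simple biset functor on $\mathbb B^{1,1}$ with $S(2^X)\neq0$ for some finite set $X$, and take such an $X$ of smallest size. Then, up to isomorphism, there is exactly one composition factor $T$ of $\hat S$ for which $T(X)\neq0$ and $T(Z)=0$ for all finite sets $Z$ with $|Z|<|X|$. It occurs with multiplicity one (there are no subfunctors $M_1\subseteq N_1\subseteq M_2\subseteq N_2$ of $\hat S$ with $N_1/M_1\cong T\cong N_2/M_2$), and $T(X)\cong S(2^X)$ as modules for the algebra of correspondences on $X$. The assignment $S\mapsto T$ is a bijection from the isomorphism classes of simple biset functors on $\mathbb B^{1,1}$ that do not vanish on all the $2^X$ to the isomorphism classes of simple correspondence functors. The same holds with $\mathbb B^{1,1}$ replaced by its full subcategory whose objects are the posets $2^X$, $X$ a finite set. -/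

import Mathlib

open CategoryTheory Opposite

universe w u v v₁ u₁

/-! ## Bisets for categories -/

/-- A `(C, D)`-biset: a functor `C × Dᵒᵖ ⥤ Set`, where `Set` is the category of finite sets. -/
abbrev Biset (C D : Type) [SmallCategory C] [SmallCategory D] : Type 1 :=
  C × Dᵒᵖ ⥤ FintypeCat.{0}

namespace Biset

section Basic

variable {C D E F : Type} [SmallCategory C] [SmallCategory D] [SmallCategory E] [SmallCategory F]

/-- The finite set `Ω(x, y)`. -/
abbrev El (Ω : Biset C D) (x : C) (y : D) : Type := Ω.obj (x, op y)

/-- The two-sided action `u ↦ α u β`. -/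
def act (Ω : Biset C D) {x x' : C} {y y' : D} (α : x ⟶ x') (β : y' ⟶ y) (u : Ω.El x y) :
    Ω.El x' y' :=
  Ω.map (X := (x, op y)) (Y := (x', op y')) (Prod.mkHom α β.op) u

theorem act_id (Ω : Biset C D) {x : C} {y : D} (u : Ω.El x y) : Ω.act (𝟙 x) (𝟙 y) u = u := by
  have h := Ω.map_id (x, op y)
  exact ConcreteCategory.congr_hom h u

theorem act_act (Ω : Biset C D) {x x' x'' : C} {y y' y'' : D} (α : x ⟶ x') (β : y' ⟶ y)
    (α' : x' ⟶ x'') (β' : y'' ⟶ y') (u : Ω.El x y) :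
    Ω.act α' β' (Ω.act α β u) = Ω.act (α ≫ α') (β' ≫ β) u := by
  have h := Ω.map_comp (X := (x, op y)) (Y := (x', op y')) (Z := (x'', op y''))
    (Prod.mkHom α β.op) (Prod.mkHom α' β'.op)
  exact (ConcreteCategory.congr_hom h u).symm

/-- A biset from its values and its two-sided action. -/
def mk' (obj : C → D → Type) [∀ x y, Finite (obj x y)]
    (act : ∀ {x x' : C} {y y' : D}, (x ⟶ x') → (y' ⟶ y) → obj x y → obj x' y')
    (hid : ∀ {x : C} {y : D} (u : obj x y), act (𝟙 x) (𝟙 y) u = u)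
    (hcomp : ∀ {x x' x'' : C} {y y' y'' : D} (α : x ⟶ x') (β : y' ⟶ y) (α' : x' ⟶ x'')
      (β' : y'' ⟶ y') (u : obj x y), act (α ≫ α') (β' ≫ β) u = act α' β' (act α β u)) :
    Biset C D where
  obj p := FintypeCat.of (obj p.1 p.2.unop)
  map f := FintypeCat.homMk (act f.1 f.2.unop)
  map_id p := by ext u; exact hid u
  map_comp f g := by ext u; exact hcomp f.1 f.2.unop g.1 g.2.unop u

/-- An isomorphism of bisets from bijections compatible with the actions. -/
def isoMk {Ω Ψ : Biset C D} (e : ∀ x y, Ω.El x y ≃ Ψ.El x y)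
    (he : ∀ {x x' : C} {y y' : D} (α : x ⟶ x') (β : y' ⟶ y) (u : Ω.El x y),
      e x' y' (Ω.act α β u) = Ψ.act α β (e x y u)) : Ω ≅ Ψ :=
  NatIso.ofComponents (fun p => FintypeCat.equivEquivIso (e p.1 p.2.unop)) (by
    intro p q f
    ext u
    exact he f.1 f.2.unop u)

/-- The bijections underlying an isomorphism of bisets. -/
def isoEquiv {Ω Ψ : Biset C D} (i : Ω ≅ Ψ) (x : C) (y : D) : Ω.El x y ≃ Ψ.El x y :=
  FintypeCat.equivEquivIso.symm (i.app (x, op y))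

theorem isoEquiv_act {Ω Ψ : Biset C D} (i : Ω ≅ Ψ) {x x' : C} {y y' : D} (α : x ⟶ x')
    (β : y' ⟶ y) (u : Ω.El x y) :
    isoEquiv i x' y' (Ω.act α β u) = Ψ.act α β (isoEquiv i x y u) := by
  have h := i.hom.naturality (X := (x, op y)) (Y := (x', op y')) (Prod.mkHom α β.op)
  exact ConcreteCategory.congr_hom h u

/-- The disjoint union of two bisets. -/
def disjUnion (Ω Ψ : Biset C D) : Biset C D :=
  mk' (fun x y => Ω.El x y ⊕ Ψ.El x y) (fun α β => Sum.map (Ω.act α β) (Ψ.act α β))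
    (by rintro x y (u | u) <;> simp [act_id])
    (by rintro x x' x'' y y' y'' α β α' β' (u | u) <;> simp [act_act])

/-- The relation generating the equivalence relation in the composition of bisets:
`(u β, v) ∼ (u, β v)`. -/
inductive CompRel (Ω : Biset C D) (Ψ : Biset D E) (x : C) (z : E) :
    (Σ y : D, Ω.El x y × Ψ.El y z) → (Σ y : D, Ω.El x y × Ψ.El y z) → Prop
  | mk {y₁ y₂ : D} (u : Ω.El x y₁) (β : y₂ ⟶ y₁) (v : Ψ.El y₂ z) :
      CompRel Ω Ψ x z ⟨y₂, Ω.act (𝟙 x) β u, v⟩ ⟨y₁, u, Ψ.act β (𝟙 z) v⟩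

/-- The value at `(x, z)` of the composite of two bisets: the quotient of
the disjoint union of the sets `Ω(x, y) × Ψ(y, z)` by the equivalence relation generated by `CompRel`. -/
def CompEl (Ω : Biset C D) (Ψ : Biset D E) (x : C) (z : E) : Type :=
  Quot (CompRel Ω Ψ x z)

instance [Finite D] (Ω : Biset C D) (Ψ : Biset D E) (x : C) (z : E) :
    Finite (CompEl Ω Ψ x z) :=
  inferInstanceAs (Finite (Quot _))

/-- The element of the composite represented by `(u, v)`. -/
def CompEl.mk {Ω : Biset C D} {Ψ : Biset D E} {x : C} {z : E} {y : D} (u : Ω.El x y)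
    (v : Ψ.El y z) : CompEl Ω Ψ x z :=
  Quot.mk _ ⟨y, u, v⟩

theorem CompEl.sound {Ω : Biset C D} {Ψ : Biset D E} {x : C} {z : E} {y₁ y₂ : D}
    (u : Ω.El x y₁) (β : y₂ ⟶ y₁) (v : Ψ.El y₂ z) :
    CompEl.mk (Ω.act (𝟙 x) β u) v = CompEl.mk u (Ψ.act β (𝟙 z) v) :=
  Quot.sound (CompRel.mk u β v)

theorem CompEl.ind {Ω : Biset C D} {Ψ : Biset D E} {x : C} {z : E}
    {p : CompEl Ω Ψ x z → Prop} (h : ∀ (y : D) (u : Ω.El x y) (v : Ψ.El y z), p (CompEl.mk u v))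
    (t : CompEl Ω Ψ x z) : p t :=
  Quot.ind (fun ⟨y, u, v⟩ => h y u v) t

/-- Maps out of the composite of two bisets. -/
def CompEl.lift {Ω : Biset C D} {Ψ : Biset D E} {x : C} {z : E} {T : Type}
    (f : ∀ y : D, Ω.El x y → Ψ.El y z → T)
    (hf : ∀ {y₁ y₂ : D} (u : Ω.El x y₁) (β : y₂ ⟶ y₁) (v : Ψ.El y₂ z),
      f y₂ (Ω.act (𝟙 x) β u) v = f y₁ u (Ψ.act β (𝟙 z) v)) (t : CompEl Ω Ψ x z) : T :=
  Quot.lift (fun p : Σ y : D, Ω.El x y × Ψ.El y z => f p.1 p.2.1 p.2.2)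
    (by rintro _ _ ⟨u, β, v⟩; exact hf u β v) t

/-- The two-sided action on the composite: `α (u, v) γ = (α u, v γ)`. -/
def CompEl.act {Ω : Biset C D} {Ψ : Biset D E} {x x' : C} {z z' : E} (α : x ⟶ x')
    (γ : z' ⟶ z) : CompEl Ω Ψ x z → CompEl Ω Ψ x' z' :=
  CompEl.lift (fun y u v => CompEl.mk (Ω.act α (𝟙 y) u) (Ψ.act (𝟙 y) γ v)) (by
    intro y₁ y₂ u β v
    have h := CompEl.sound (Ω.act α (𝟙 y₁) u) β (Ψ.act (𝟙 y₂) γ v)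
    simpa [act_act] using h)

/-- The composite `Ω ∘ Ψ` of bisets. -/
def comp [Finite D] (Ω : Biset C D) (Ψ : Biset D E) : Biset C E :=
  mk' (CompEl Ω Ψ) CompEl.act
    (by
      intro x z t
      induction t using CompEl.ind with
      | h y u v =>
        change CompEl.mk _ _ = _
        rw [act_id, act_id])
    (by
      intro x x' x'' z z' z'' α γ α' γ' t
      induction t using CompEl.ind with
      | h y u v =>
        change CompEl.mk _ _ = CompEl.mk _ _
        simp [act_act])

/-- The biset `(x, y) ↦ Hom(F y, x)` attached to a functor `F : C ⥤ D`. -/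
def ofFunctor [∀ x y : D, Finite (x ⟶ y)] (G : C ⥤ D) : Biset D C :=
  mk' (fun x y => (G.obj y ⟶ x)) (fun α β φ => G.map β ≫ φ ≫ α) (by simp) (by simp)

/-- The identity biset `(x, y) ↦ Hom(y, x)`. -/
def idBiset (C : Type) [SmallCategory C] [∀ x y : C, Finite (x ⟶ y)] : Biset C C :=
  mk' (fun x y => (y ⟶ x)) (fun α β φ => β ≫ φ ≫ α) (by simp) (by simp)

/-! ### Isomorphisms between composites -/

theorem ofFunctor_act [∀ x y : D, Finite (x ⟶ y)] (G : C ⥤ D) {x x' : D} {y y' : C}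
    (α : x ⟶ x') (β : y' ⟶ y) (φ : G.obj y ⟶ x) :
    (ofFunctor G).act α β φ = (G.map β ≫ φ ≫ α : G.obj y' ⟶ x') := rfl

theorem idBiset_act [∀ x y : C, Finite (x ⟶ y)] {x x' y y' : C}
    (α : x ⟶ x') (β : y' ⟶ y) (φ : y ⟶ x) :
    (idBiset C).act α β φ = (β ≫ φ ≫ α : y' ⟶ x') := rfl

theorem act_compMk [Finite D] (Ω : Biset C D) (Ψ : Biset D E) {x x' : C} {z z' : E} {y : D}
    (α : x ⟶ x') (γ : z' ⟶ z) (u : Ω.El x y) (v : Ψ.El y z) :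
    (comp Ω Ψ).act α γ (CompEl.mk u v) =
      (CompEl.mk (Ω.act α (𝟙 y) u) (Ψ.act (𝟙 y) γ v) : CompEl Ω Ψ x' z') := rfl

/-- Maps between values of composites induced by equivariant maps. -/
def CompEl.map {Ω Ω' : Biset C D} {Ψ Ψ' : Biset D E} (i : Ω ≅ Ω') (j : Ψ ≅ Ψ') (x : C) (z : E) :
    CompEl Ω Ψ x z → CompEl Ω' Ψ' x z :=
  CompEl.lift (fun y u v => CompEl.mk (isoEquiv i x y u) (isoEquiv j y z v)) (by
    intro y₁ y₂ u β v
    rw [isoEquiv_act, isoEquiv_act]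
    exact CompEl.sound _ _ _)

theorem isoEquiv_symm_apply {Ω Ψ : Biset C D} (i : Ω ≅ Ψ) (x : C) (y : D) (u : Ω.El x y) :
    isoEquiv i.symm x y (isoEquiv i x y u) = u :=
  (isoEquiv i x y).symm_apply_apply u

theorem isoEquiv_apply_symm {Ω Ψ : Biset C D} (i : Ω ≅ Ψ) (x : C) (y : D) (u : Ψ.El x y) :
    isoEquiv i x y (isoEquiv i.symm x y u) = u :=
  (isoEquiv i x y).apply_symm_apply u

/-- Composition of bisets respects isomorphism. -/
def compCongr [Finite D] {Ω Ω' : Biset C D} {Ψ Ψ' : Biset D E} (i : Ω ≅ Ω') (j : Ψ ≅ Ψ') :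
    comp Ω Ψ ≅ comp Ω' Ψ' :=
  isoMk (fun x z =>
    { toFun := CompEl.map i j x z
      invFun := CompEl.map i.symm j.symm x z
      left_inv := by
        intro t
        induction t using CompEl.ind with
        | h y u v =>
          change CompEl.mk _ _ = _
          rw [isoEquiv_symm_apply, isoEquiv_symm_apply]
      right_inv := by
        intro t
        induction t using CompEl.ind with
        | h y u v =>
          change CompEl.mk _ _ = _
          rw [isoEquiv_apply_symm, isoEquiv_apply_symm] }) (by
    intro x x' z z' α γ t
    induction t using CompEl.ind with
    | h y u v =>
      change CompEl.mk _ _ = CompEl.mk _ _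
      rw [isoEquiv_act, isoEquiv_act])

/-- Composition of bisets distributes over disjoint unions on the left. -/
def disjUnionComp [Finite D] (Ω Ω' : Biset C D) (Ψ : Biset D E) :
    comp (disjUnion Ω Ω') Ψ ≅ disjUnion (comp Ω Ψ) (comp Ω' Ψ) :=
  isoMk (fun x z =>
    { toFun := CompEl.lift (Ω := disjUnion Ω Ω') (Ψ := Ψ)
        (T := CompEl Ω Ψ x z ⊕ CompEl Ω' Ψ x z)
        (fun y (u : Ω.El x y ⊕ Ω'.El x y) v =>
          Sum.map (fun u => CompEl.mk u v) (fun u => CompEl.mk u v) u)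
        (by
          rintro y₁ y₂ (u | u) β v
          · exact congrArg Sum.inl (CompEl.sound u β v)
          · exact congrArg Sum.inr (CompEl.sound u β v))
      invFun := Sum.elim
        (CompEl.lift (fun y u v => CompEl.mk (Ω := disjUnion Ω Ω') (Sum.inl u) v)
          (fun u β v => CompEl.sound (Ω := disjUnion Ω Ω') (Sum.inl u) β v))
        (CompEl.lift (fun y u v => CompEl.mk (Ω := disjUnion Ω Ω') (Sum.inr u) v)
          (fun u β v => CompEl.sound (Ω := disjUnion Ω Ω') (Sum.inr u) β v))
      left_inv := by
        intro t
        induction t using CompEl.ind with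
        | h y u v => rcases u with u | u <;> rfl
      right_inv := by
        rintro (t | t) <;> induction t using CompEl.ind with
        | h y u v => rfl }) (by
    intro x x' z z' α γ t
    induction t using CompEl.ind with
    | h y u v => rcases u with u | u <;> rfl)

/-- Composition of bisets distributes over disjoint unions on the right. -/
def compDisjUnion [Finite D] (Ω : Biset C D) (Ψ Ψ' : Biset D E) :
    comp Ω (disjUnion Ψ Ψ') ≅ disjUnion (comp Ω Ψ) (comp Ω Ψ') :=
  isoMk (fun x z =>
    { toFun := CompEl.lift (Ω := Ω) (Ψ := disjUnion Ψ Ψ')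
        (T := CompEl Ω Ψ x z ⊕ CompEl Ω Ψ' x z)
        (fun y u (v : Ψ.El y z ⊕ Ψ'.El y z) =>
          Sum.map (fun v => CompEl.mk u v) (fun v => CompEl.mk u v) v)
        (by
          rintro y₁ y₂ u β (v | v)
          · exact congrArg Sum.inl (CompEl.sound u β v)
          · exact congrArg Sum.inr (CompEl.sound u β v))
      invFun := Sum.elim
        (CompEl.lift (fun y u v => CompEl.mk (Ψ := disjUnion Ψ Ψ') u (Sum.inl v))
          (fun u β v => CompEl.sound (Ψ := disjUnion Ψ Ψ') u β (Sum.inl v)))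
        (CompEl.lift (fun y u v => CompEl.mk (Ψ := disjUnion Ψ Ψ') u (Sum.inr v))
          (fun u β v => CompEl.sound (Ψ := disjUnion Ψ Ψ') u β (Sum.inr v)))
      left_inv := by
        intro t
        induction t using CompEl.ind with
        | h y u v => rcases v with v | v <;> rfl
      right_inv := by
        rintro (t | t) <;> induction t using CompEl.ind with
        | h y u v => rfl }) (by
    intro x x' z z' α γ t
    induction t using CompEl.ind with
    | h y u v => rcases v with v | v <;> rfl)

/-- Composition of bisets is associative up to isomorphism. -/
def compAssoc [Finite D] [Finite E] (Ω : Biset C D) (Ψ : Biset D E) (Θ : Biset E F) :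
    comp (comp Ω Ψ) Θ ≅ comp Ω (comp Ψ Θ) :=
  isoMk (fun x w =>
    { toFun := CompEl.lift (Ω := comp Ω Ψ) (Ψ := Θ) (T := CompEl Ω (comp Ψ Θ) x w)
        (fun z (t : CompEl Ω Ψ x z) r =>
          CompEl.lift (fun y u v => CompEl.mk (Ψ := comp Ψ Θ) u (CompEl.mk v r))
            (by
              intro y₁ y₂ u β v
              have h := CompEl.sound (Ψ := comp Ψ Θ) u β (CompEl.mk v r)
              rw [act_compMk, act_id] at h
              exact h) t)
        (by
          intro z₁ z₂ t γ r
          induction t using CompEl.ind with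
          | h y u v =>
            have h₁ : Ω.act (𝟙 x) (𝟙 y) u = u := act_id Ω u
            have h₂ := CompEl.sound v γ r
            exact (congrArg (fun a => CompEl.mk (Ψ := comp Ψ Θ) a
              (CompEl.mk (Ψ.act (𝟙 y) γ v) r)) h₁).trans
                (congrArg (fun b => CompEl.mk (Ψ := comp Ψ Θ) u b) h₂))
      invFun := CompEl.lift (Ω := Ω) (Ψ := comp Ψ Θ) (T := CompEl (comp Ω Ψ) Θ x w)
        (fun y u (t : CompEl Ψ Θ y w) =>
          CompEl.lift (fun z v r => CompEl.mk (Ω := comp Ω Ψ) (CompEl.mk u v) r)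
            (by
              intro z₁ z₂ v γ r
              have h := CompEl.sound (Ω := comp Ω Ψ) (CompEl.mk u v) γ r
              rw [act_compMk, act_id] at h
              exact h) t)
        (by
          intro y₁ y₂ u β t
          induction t using CompEl.ind with
          | h z v r =>
            have h₁ : Θ.act (𝟙 z) (𝟙 w) r = r := act_id Θ r
            have h₂ := CompEl.sound u β v
            exact (congrArg (fun b => CompEl.mk (Ω := comp Ω Ψ) b r) h₂).trans
              (congrArg (fun a => CompEl.mk (Ω := comp Ω Ψ)
                (CompEl.mk u (Ψ.act β (𝟙 z) v)) a) h₁.symm))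
      left_inv := by
        intro t
        induction t using CompEl.ind with
        | h z t r =>
          induction t using CompEl.ind with
          | h y u v => rfl
      right_inv := by
        intro t
        induction t using CompEl.ind with
        | h y u t =>
          induction t using CompEl.ind with
          | h z v r => rfl }) (by
    intro x x' w w' α δ t
    induction t using CompEl.ind with
    | h z t r =>
      induction t using CompEl.ind with
      | h y u v =>
        change CompEl.mk (Ω := Ω) (Ψ := comp Ψ Θ) (Ω.act _ _ u) (CompEl.mk _ _) =
          CompEl.mk (Ω := Ω) (Ψ := comp Ψ Θ) (Ω.act _ _ u) (CompEl.mk _ _)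
        rfl)

/-- The identity biset is a left identity for composition. -/
def idComp [Finite C] [∀ x y : C, Finite (x ⟶ y)] (Ω : Biset C D) :
    comp (idBiset C) Ω ≅ Ω :=
  isoMk (fun x z =>
    { toFun := CompEl.lift (Ω := idBiset C) (Ψ := Ω)
        (fun y (α : y ⟶ x) r => Ω.act α (𝟙 z) r)
        (by
          intro y₁ y₂ u β v
          have aux : ∀ (u : y₁ ⟶ x) (v : Ω.El y₂ z),
              Ω.act (β ≫ u ≫ 𝟙 x) (𝟙 z) v = Ω.act u (𝟙 z) (Ω.act β (𝟙 z) v) := by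
            intro u v
            rw [act_act]
            simp
          exact aux u v)
      invFun r := CompEl.mk (Ω := idBiset C) (𝟙 x : x ⟶ x) r
      left_inv := by
        intro t
        induction t using CompEl.ind with
        | h y u v =>
          have aux : ∀ u : y ⟶ x, u ≫ 𝟙 x ≫ 𝟙 x = u := by simp
          exact (CompEl.sound (Ω := idBiset C) (𝟙 x : x ⟶ x) u v).symm.trans
            (congrArg (fun w => CompEl.mk (Ω := idBiset C) w v) (aux u))
      right_inv := fun r => act_id Ω r }) (by
    intro x x' z z' α γ t
    induction t using CompEl.ind with
    | h y u v =>
      have aux : ∀ (u : y ⟶ x) (v : Ω.El y z), Ω.act (𝟙 y ≫ u ≫ α) (𝟙 z') (Ω.act (𝟙 y) γ v) =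
          Ω.act α γ (Ω.act u (𝟙 z) v) := by
        intro u v
        rw [act_act, act_act]
        simp
      exact aux u v)

/-- The identity biset is a right identity for composition. -/
def compId [Finite D] [∀ x y : D, Finite (x ⟶ y)] (Ω : Biset C D) :
    comp Ω (idBiset D) ≅ Ω :=
  isoMk (fun x z =>
    { toFun := CompEl.lift (Ω := Ω) (Ψ := idBiset D)
        (fun y u (β : z ⟶ y) => Ω.act (𝟙 x) β u)
        (by
          intro y₁ y₂ u β v
          have aux : ∀ (u : Ω.El x y₁) (v : z ⟶ y₂),
              Ω.act (𝟙 x) v (Ω.act (𝟙 x) β u) = Ω.act (𝟙 x) (𝟙 z ≫ v ≫ β) u := by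
            intro u v
            rw [act_act]
            simp
          exact aux u v)
      invFun r := CompEl.mk (Ψ := idBiset D) r (𝟙 z : z ⟶ z)
      left_inv := by
        intro t
        induction t using CompEl.ind with
        | h y u v =>
          have aux : ∀ v : z ⟶ y, 𝟙 z ≫ 𝟙 z ≫ v = v := by simp
          exact (CompEl.sound (Ψ := idBiset D) u v (𝟙 z : z ⟶ z)).trans
            (congrArg (fun w => CompEl.mk (Ψ := idBiset D) u w) (aux v))
      right_inv := fun r => act_id Ω r }) (by
    intro x x' z z' α γ t
    induction t using CompEl.ind with
    | h y u v =>
      have aux : ∀ (u : Ω.El x y) (v : z ⟶ y),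
          Ω.act (𝟙 x') (γ ≫ v ≫ 𝟙 y) (Ω.act α (𝟙 y) u) = Ω.act α γ (Ω.act (𝟙 x) v u) := by
        intro u v
        rw [act_act, act_act]
        simp
      exact aux u v)

theorem ofFunctor_sound [∀ x y : D, Finite (x ⟶ y)] [∀ x y : E, Finite (x ⟶ y)]
    (G : C ⥤ D) (H : D ⥤ E) {z : E} {x : C} {y : D} (φ : H.obj y ⟶ z) (ψ : G.obj x ⟶ y) :
    CompEl.mk (Ω := ofFunctor H) (Ψ := ofFunctor G) (H.map ψ ≫ φ)
        (𝟙 (G.obj x) : G.obj x ⟶ G.obj x) =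
      CompEl.mk (Ω := ofFunctor H) (Ψ := ofFunctor G) φ ψ := by
  have h := CompEl.sound (Ω := ofFunctor H) (Ψ := ofFunctor G) φ ψ
    (𝟙 (G.obj x) : G.obj x ⟶ G.obj x)
  have h₁ : H.map ψ ≫ φ ≫ 𝟙 z = H.map ψ ≫ φ := by simp
  have h₂ : G.map (𝟙 x) ≫ 𝟙 (G.obj x) ≫ ψ = ψ := by simp
  exact (congrArg (fun a => CompEl.mk (Ω := ofFunctor H) (Ψ := ofFunctor G) a
    (𝟙 (G.obj x) : G.obj x ⟶ G.obj x)) h₁).symm.trans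
      (h.trans (congrArg (fun b => CompEl.mk (Ω := ofFunctor H) (Ψ := ofFunctor G) φ b) h₂))

/-- The biset attached to a composite of functors is the composite of the bisets. -/
def ofFunctorComp [Finite D] [∀ x y : D, Finite (x ⟶ y)] [∀ x y : E, Finite (x ⟶ y)]
    (G : C ⥤ D) (H : D ⥤ E) :
    ofFunctor (G ⋙ H) ≅ comp (ofFunctor H) (ofFunctor G) :=
  isoMk (fun z x =>
    { toFun := fun φ : H.obj (G.obj x) ⟶ z =>
        CompEl.mk (Ω := ofFunctor H) (Ψ := ofFunctor G) φ (𝟙 (G.obj x) : G.obj x ⟶ G.obj x)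
      invFun := CompEl.lift (Ω := ofFunctor H) (Ψ := ofFunctor G)
        (fun y (φ : H.obj y ⟶ z) (ψ : G.obj x ⟶ y) => (H.map ψ ≫ φ : H.obj (G.obj x) ⟶ z))
        (by
          intro y₁ y₂ u β v
          have aux : ∀ (u : H.obj y₁ ⟶ z) (v : G.obj x ⟶ y₂),
              H.map v ≫ H.map β ≫ u ≫ 𝟙 z = H.map (G.map (𝟙 x) ≫ v ≫ β) ≫ u := by simp
          exact aux u v)
      left_inv := by
        intro φ
        have aux : ∀ φ : H.obj (G.obj x) ⟶ z, H.map (𝟙 (G.obj x)) ≫ φ = φ := by simp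
        exact aux φ
      right_inv := by
        intro t
        induction t using CompEl.ind with
        | h y u v => exact ofFunctor_sound G H u v }) (by
    intro z z' x x' α β φ
    have aux : ∀ φ : H.obj (G.obj x) ⟶ z,
        CompEl.mk (Ω := ofFunctor H) (Ψ := ofFunctor G)
          (H.map (G.map β) ≫ φ ≫ α) (𝟙 (G.obj x') : G.obj x' ⟶ G.obj x') =
        CompEl.mk (Ω := ofFunctor H) (Ψ := ofFunctor G) (H.map (𝟙 (G.obj x)) ≫ φ ≫ α)
          (G.map β ≫ 𝟙 (G.obj x) ≫ 𝟙 (G.obj x)) := by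
      intro φ
      have h₁ : H.map (𝟙 (G.obj x)) ≫ φ ≫ α = φ ≫ α := by simp
      have h₂ : G.map β ≫ 𝟙 (G.obj x) ≫ 𝟙 (G.obj x) = G.map β := by simp
      rw [h₁, h₂]
      exact ofFunctor_sound G H (φ ≫ α) (G.map β)
    exact aux φ)

/-- The biset attached to the identity functor is the identity biset. -/
def ofFunctorId [∀ x y : C, Finite (x ⟶ y)] : ofFunctor (𝟭 C) ≅ idBiset C :=
  Iso.refl _

end Basic

/-! ### Representable sets and birepresentable bisets -/

section Representable

/-- The disjoint union of the representable functors `Hom(s i, -)`. -/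
def sumHom {C : Type} [SmallCategory C] {I : Type} (s : I → C) : C ⥤ Type where
  obj x := Σ i : I, (s i ⟶ x)
  map f := TypeCat.ofHom (fun p => ⟨p.1, p.2 ≫ f⟩)

/-- A `C`-set is representable if it is isomorphic to a disjoint union of sets of the form
`Hom(x, -)`. -/
def IsRepresentableSet {C : Type} [SmallCategory C] (P : C ⥤ Type) : Prop :=
  ∃ (I : Type) (s : I → C), Nonempty (P ≅ sumHom s)

variable {C D E : Type} [SmallCategory C] [SmallCategory D] [SmallCategory E]

/-- A `(C, D)`-biset regarded as a left `C`-set: its value at `x` is the disjoint union of the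
sets `Ω(x, y)`. -/
def leftSet (Ω : Biset C D) : C ⥤ Type where
  obj x := Σ y : D, Ω.El x y
  map α := TypeCat.ofHom (fun p => ⟨p.1, Ω.act α (𝟙 p.1) p.2⟩)
  map_id x := by
    refine ConcreteCategory.hom_ext _ _ (fun ⟨y, u⟩ => ?_)
    exact congrArg (fun w => (⟨y, w⟩ : Σ y : D, Ω.El x y)) (act_id Ω u)
  map_comp {x x' x''} α α' := by
    refine ConcreteCategory.hom_ext _ _ (fun ⟨y, u⟩ => ?_)
    refine congrArg (fun w => (⟨y, w⟩ : Σ y : D, Ω.El x'' y)) ?_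
    change Ω.act (α ≫ α') (𝟙 y) u = Ω.act α' (𝟙 y) (Ω.act α (𝟙 y) u)
    rw [act_act]
    simp

/-- A `(C, D)`-biset regarded as a right `D`-set: its value at `y` is the disjoint union of
the sets `Ω(x, y)`. -/
def rightSet (Ω : Biset C D) : Dᵒᵖ ⥤ Type where
  obj y := Σ x : C, Ω.El x y.unop
  map β := TypeCat.ofHom (fun p => ⟨p.1, Ω.act (𝟙 p.1) β.unop p.2⟩)
  map_id y := by
    refine ConcreteCategory.hom_ext _ _ (fun ⟨x, u⟩ => ?_)
    exact congrArg (fun w => (⟨x, w⟩ : Σ x : C, Ω.El x y.unop)) (act_id Ω u)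
  map_comp {y y' y''} β β' := by
    refine ConcreteCategory.hom_ext _ _ (fun ⟨x, u⟩ => ?_)
    refine congrArg (fun w => (⟨x, w⟩ : Σ x : C, Ω.El x y''.unop)) ?_
    change Ω.act (𝟙 x) (β'.unop ≫ β.unop) u = Ω.act (𝟙 x) β'.unop (Ω.act (𝟙 x) β.unop u)
    rw [act_act]
    simp

/-- A biset is birepresentable if it is representable both as a left set and as a right set. -/
def IsBirepresentable (Ω : Biset C D) : Prop :=
  IsRepresentableSet Ω.leftSet ∧ IsRepresentableSet Ω.rightSet

theorem isRepresentableSet_iff (P : C ⥤ Type) :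
    IsRepresentableSet P ↔ ∃ (I : Type) (s : I → C) (g : ∀ i, P.obj (s i)),
      ∀ (x : C) (u : P.obj x), ∃! p : Σ i, (s i ⟶ x), P.map p.2 (g p.1) = u := by
  constructor
  · rintro ⟨I, s, ⟨e⟩⟩
    have key : ∀ (x : C) (p : Σ i, (s i ⟶ x)),
        P.map p.2 (e.inv.app (s p.1) (⟨p.1, 𝟙 _⟩ : Σ i, (s i ⟶ s p.1))) = e.inv.app x p := by
      intro x p
      have h := ConcreteCategory.congr_hom (e.inv.naturality p.2)
        (⟨p.1, 𝟙 _⟩ : Σ i, (s i ⟶ s p.1))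
      refine Eq.trans h.symm ?_
      change e.inv.app x (⟨p.1, 𝟙 _ ≫ p.2⟩ : Σ i, (s i ⟶ x)) = _
      rw [Category.id_comp]
    refine ⟨I, s, fun i => e.inv.app (s i) (⟨i, 𝟙 _⟩ : Σ j, (s j ⟶ s i)), fun x u => ?_⟩
    refine ⟨e.hom.app x u, ?_, ?_⟩
    · refine Eq.trans (key x (e.hom.app x u)) ?_
      exact ConcreteCategory.congr_hom (e.hom_inv_id_app x) u
    · intro p hp
      have hp' : e.inv.app x p = u := (key x p).symm.trans hp
      rw [← hp']
      exact (ConcreteCategory.congr_hom (e.inv_hom_id_app x) p).symm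
  · rintro ⟨I, s, g, h⟩
    refine ⟨I, s, ⟨(NatIso.ofComponents (fun x => Equiv.toIso
      (Equiv.ofBijective (fun p : Σ i, (s i ⟶ x) => P.map p.2 (g p.1))
        ((Function.bijective_iff_existsUnique _).2 (h x)))) ?_).symm⟩⟩
    intro x y f
    ext p
    exact ConcreteCategory.congr_hom (P.map_comp p.2 f) (g p.1)

theorem leftRepresentable_iff (Ω : Biset C D) :
    IsRepresentableSet Ω.leftSet ↔ ∀ y : D, ∃ (I : Type) (s : I → C) (g : ∀ i, Ω.El (s i) y),
      ∀ (x : C) (u : Ω.El x y), ∃! p : Σ i, (s i ⟶ x), Ω.act p.2 (𝟙 y) (g p.1) = u := by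
  rw [isRepresentableSet_iff]
  constructor
  · rintro ⟨I, s, g, h⟩ y
    have hg : ∀ i : {i : I // (g i).1 = y}, ∃ g' : Ω.El (s i.1) y, g i.1 = ⟨y, g'⟩ := by
      rintro ⟨i, rfl⟩
      exact ⟨(g i).2, rfl⟩
    choose g' hg' using hg
    have act_eq : ∀ (x : C) (i : {i : I // (g i).1 = y}) (f : s i.1 ⟶ x),
        Ω.leftSet.map f (g i.1) = ⟨y, Ω.act f (𝟙 y) (g' i)⟩ := by
      intro x i f
      rw [hg' i]
      rfl
    refine ⟨{i : I // (g i).1 = y}, fun i => s i.1, g', fun x u => ?_⟩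
    obtain ⟨⟨i, f⟩, hp, huniq⟩ := h x ⟨y, u⟩
    have hi : (g i).1 = y := congrArg Sigma.fst hp
    refine ⟨⟨⟨i, hi⟩, f⟩, ?_, ?_⟩
    · have h₁ := (act_eq x ⟨i, hi⟩ f).symm.trans hp
      exact eq_of_heq (Sigma.mk.inj h₁).2
    · rintro ⟨⟨j, hj⟩, f'⟩ hf'
      have h₁ := huniq ⟨j, f'⟩ ((act_eq x ⟨j, hj⟩ f').trans (by
        change (⟨y, _⟩ : Σ y : D, Ω.El x y) = ⟨y, u⟩
        exact Sigma.ext rfl (heq_of_eq hf')))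
      cases h₁
      rfl
  · intro h
    choose I s g h using h
    refine ⟨Σ y, I y, fun i => s i.1 i.2, fun i => ⟨i.1, g i.1 i.2⟩, ?_⟩
    rintro x ⟨y, u⟩
    obtain ⟨⟨i, f⟩, hp, huniq⟩ := h y x u
    refine ⟨⟨⟨y, i⟩, f⟩, Sigma.ext rfl (heq_of_eq hp), ?_⟩
    rintro ⟨⟨y', j⟩, f'⟩ hf'
    have hy : y' = y := congrArg Sigma.fst hf'
    subst hy
    have h₁ := huniq ⟨j, f'⟩ (eq_of_heq (Sigma.mk.inj hf').2)
    cases h₁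
    rfl

theorem rightRepresentable_iff (Ω : Biset C D) :
    IsRepresentableSet Ω.rightSet ↔ ∀ x : C, ∃ (I : Type) (s : I → D) (g : ∀ i, Ω.El x (s i)),
      ∀ (y : D) (u : Ω.El x y), ∃! p : Σ i, (y ⟶ s i), Ω.act (𝟙 x) p.2 (g p.1) = u := by
  rw [isRepresentableSet_iff]
  constructor
  · rintro ⟨I, s, g, h⟩ x
    have hg : ∀ i : {i : I // (g i).1 = x}, ∃ g' : Ω.El x (s i.1).unop, g i.1 = ⟨x, g'⟩ := by
      rintro ⟨i, rfl⟩
      exact ⟨(g i).2, rfl⟩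
    choose g' hg' using hg
    have act_eq : ∀ (y : D) (i : {i : I // (g i).1 = x}) (f : y ⟶ (s i.1).unop),
        Ω.rightSet.map (Y := op y) f.op (g i.1) = ⟨x, Ω.act (𝟙 x) f (g' i)⟩ := by
      intro y i f
      rw [hg' i]
      rfl
    refine ⟨{i : I // (g i).1 = x}, fun i => (s i.1).unop, g', fun y u => ?_⟩
    obtain ⟨⟨i, f⟩, hp, huniq⟩ := h (op y) ⟨x, u⟩
    have hi : (g i).1 = x := congrArg Sigma.fst hp
    refine ⟨⟨⟨i, hi⟩, f.unop⟩, ?_, ?_⟩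
    · have h₁ := (act_eq y ⟨i, hi⟩ f.unop).symm.trans hp
      exact eq_of_heq (Sigma.mk.inj h₁).2
    · rintro ⟨⟨j, hj⟩, f'⟩ hf'
      have h₁ := huniq ⟨j, f'.op⟩ ((act_eq y ⟨j, hj⟩ f').trans (by
        change (⟨x, _⟩ : Σ x : C, Ω.El x y) = ⟨x, u⟩
        exact Sigma.ext rfl (heq_of_eq hf')))
      cases h₁
      rfl
  · intro h
    choose I s g h using h
    refine ⟨Σ x, I x, fun i => op (s i.1 i.2), fun i => ⟨i.1, g i.1 i.2⟩, ?_⟩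
    rintro y ⟨x, u⟩
    obtain ⟨⟨i, f⟩, hp, huniq⟩ := h x y.unop u
    refine ⟨⟨⟨x, i⟩, f.op⟩, Sigma.ext rfl (heq_of_eq hp), ?_⟩
    rintro ⟨⟨x', j⟩, f'⟩ hf'
    have hx : x' = x := congrArg Sigma.fst hf'
    subst hx
    have h₁ := huniq ⟨j, f'.unop⟩ (eq_of_heq (Sigma.mk.inj hf').2)
    cases h₁
    rfl

theorem leftRepresentable_comp [Finite D] {Ω : Biset C D} {Ψ : Biset D E}
    (hΩ : IsRepresentableSet Ω.leftSet) (hΨ : IsRepresentableSet Ψ.leftSet) :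
    IsRepresentableSet (comp Ω Ψ).leftSet := by
  rw [leftRepresentable_iff] at *
  intro z
  obtain ⟨J, t, k, hk⟩ := hΨ z
  choose I s g hg using hΩ
  -- every class has a unique representative whose second entry is one of the generators
  choose q hq hq' using hk
  let red : ∀ x : C, CompEl Ω Ψ x z → Σ j : J, Ω.El x (t j) := fun x =>
    CompEl.lift (fun y u v => ⟨(q y v).1, Ω.act (𝟙 x) (q y v).2 u⟩) (by
      intro y₁ y₂ u β v
      have h : (⟨(q y₂ v).1, (q y₂ v).2 ≫ β⟩ : Σ j, (t j ⟶ y₁)) = q y₁ (Ψ.act β (𝟙 z) v) := by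
        apply hq'
        change Ψ.act ((q y₂ v).2 ≫ β) (𝟙 z) (k (q y₂ v).1) = _
        conv_rhs => rw [← hq y₂ v]
        rw [act_act]
        simp
      rw [← h, act_act]
      simp)
  have red_mk : ∀ (x : C) (j : J) (u : Ω.El x (t j)),
      red x (CompEl.mk u (k j)) = ⟨j, u⟩ := by
    intro x j u
    have h : (⟨j, 𝟙 (t j)⟩ : Σ j', (t j' ⟶ t j)) = q (t j) (k j) := hq' _ _ _ (act_id Ψ (k j))
    change (⟨(q (t j) (k j)).1, Ω.act (𝟙 x) (q (t j) (k j)).2 u⟩ : Σ j : J, Ω.El x (t j)) = _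
    rw [← h, act_id]
  refine ⟨Σ j, I (t j), fun i => s _ i.2, fun i => CompEl.mk (g _ i.2) (k i.1), fun x c => ?_⟩
  have hact : ∀ p : Σ i : (Σ j, I (t j)), (s _ i.2 ⟶ x),
      (comp Ω Ψ).act p.2 (𝟙 z) (CompEl.mk (g _ p.1.2) (k p.1.1)) =
        (CompEl.mk (Ω.act p.2 (𝟙 _) (g _ p.1.2)) (k p.1.1) : CompEl Ω Ψ x z) := by
    intro p
    rw [act_compMk, act_id]
  induction c using CompEl.ind with
  | h y u v =>
    obtain ⟨j, u', hu⟩ : ∃ (j : J) (u' : Ω.El x (t j)),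
        (CompEl.mk u v : CompEl Ω Ψ x z) = CompEl.mk u' (k j) := by
      refine ⟨(q y v).1, Ω.act (𝟙 x) (q y v).2 u, ?_⟩
      conv_lhs => rw [← hq y v]
      exact (CompEl.sound _ _ _).symm
    obtain ⟨⟨i, f⟩, hp, huniq⟩ := hg (t j) x u'
    have hp' : Ω.act f (𝟙 _) (g (t j) i) = u' := hp
    refine ⟨⟨⟨j, i⟩, f⟩, ?_, ?_⟩
    · refine (hact ⟨⟨j, i⟩, f⟩).trans ?_
      rw [hu]
      exact congrArg (fun w => (CompEl.mk w (k j) : CompEl Ω Ψ x z)) hp'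
    · rintro ⟨⟨j', i'⟩, f'⟩ hf'
      have h₁ := (hact ⟨⟨j', i'⟩, f'⟩).symm.trans (hf'.trans hu)
      have h₂ := (red_mk x j' _).symm.trans ((congrArg (red x) h₁).trans (red_mk x j u'))
      have hj : j' = j := congrArg Sigma.fst h₂
      subst hj
      have h₃ := huniq ⟨i', f'⟩ (eq_of_heq (Sigma.mk.inj h₂).2)
      cases h₃
      rfl

theorem rightRepresentable_comp [Finite D] {Ω : Biset C D} {Ψ : Biset D E}
    (hΩ : IsRepresentableSet Ω.rightSet) (hΨ : IsRepresentableSet Ψ.rightSet) :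
    IsRepresentableSet (comp Ω Ψ).rightSet := by
  rw [rightRepresentable_iff] at *
  intro x
  obtain ⟨J, t, k, hk⟩ := hΩ x
  choose I s g hg using hΨ
  choose q hq hq' using hk
  let red : ∀ z : E, CompEl Ω Ψ x z → Σ j : J, Ψ.El (t j) z := fun z =>
    CompEl.lift (fun y u v => ⟨(q y u).1, Ψ.act (q y u).2 (𝟙 z) v⟩) (by
      intro y₁ y₂ u β v
      have h : (⟨(q y₁ u).1, β ≫ (q y₁ u).2⟩ : Σ j, (y₂ ⟶ t j)) = q y₂ (Ω.act (𝟙 x) β u) := by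
        apply hq'
        change Ω.act (𝟙 x) (β ≫ (q y₁ u).2) (k (q y₁ u).1) = _
        conv_rhs => rw [← hq y₁ u]
        rw [act_act]
        simp
      rw [← h, act_act]
      simp)
  have red_mk : ∀ (z : E) (j : J) (v : Ψ.El (t j) z),
      red z (CompEl.mk (k j) v) = ⟨j, v⟩ := by
    intro z j v
    have h : (⟨j, 𝟙 (t j)⟩ : Σ j', (t j ⟶ t j')) = q (t j) (k j) := hq' _ _ _ (act_id Ω (k j))
    change (⟨(q (t j) (k j)).1, Ψ.act (q (t j) (k j)).2 (𝟙 z) v⟩ : Σ j : J, Ψ.El (t j) z) = _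
    rw [← h, act_id]
  refine ⟨Σ j, I (t j), fun i => s _ i.2, fun i => CompEl.mk (k i.1) (g _ i.2), fun z c => ?_⟩
  have hact : ∀ p : Σ i : (Σ j, I (t j)), (z ⟶ s _ i.2),
      (comp Ω Ψ).act (𝟙 x) p.2 (CompEl.mk (k p.1.1) (g _ p.1.2)) =
        (CompEl.mk (k p.1.1) (Ψ.act (𝟙 _) p.2 (g _ p.1.2)) : CompEl Ω Ψ x z) := by
    intro p
    rw [act_compMk, act_id]
  induction c using CompEl.ind with
  | h y u v =>
    obtain ⟨j, v', hv⟩ : ∃ (j : J) (v' : Ψ.El (t j) z),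
        (CompEl.mk u v : CompEl Ω Ψ x z) = CompEl.mk (k j) v' := by
      refine ⟨(q y u).1, Ψ.act (q y u).2 (𝟙 z) v, ?_⟩
      conv_lhs => rw [← hq y u]
      exact CompEl.sound _ _ _
    obtain ⟨⟨i, f⟩, hp, huniq⟩ := hg (t j) z v'
    have hp' : Ψ.act (𝟙 _) f (g (t j) i) = v' := hp
    refine ⟨⟨⟨j, i⟩, f⟩, ?_, ?_⟩
    · refine (hact ⟨⟨j, i⟩, f⟩).trans ?_
      rw [hv]
      exact congrArg (fun w => (CompEl.mk (k j) w : CompEl Ω Ψ x z)) hp'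
    · rintro ⟨⟨j', i'⟩, f'⟩ hf'
      have h₁ := (hact ⟨⟨j', i'⟩, f'⟩).symm.trans (hf'.trans hv)
      have h₂ := (red_mk z j' _).symm.trans ((congrArg (red z) h₁).trans (red_mk z j v'))
      have hj : j' = j := congrArg Sigma.fst h₂
      subst hj
      have h₃ := huniq ⟨i', f'⟩ (eq_of_heq (Sigma.mk.inj h₂).2)
      cases h₃
      rfl

theorem IsBirepresentable.comp [Finite D] {Ω : Biset C D} {Ψ : Biset D E}
    (hΩ : Ω.IsBirepresentable) (hΨ : Ψ.IsBirepresentable) : (Ω.comp Ψ).IsBirepresentable :=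
  ⟨leftRepresentable_comp hΩ.1 hΨ.1, rightRepresentable_comp hΩ.2 hΨ.2⟩

theorem isBirepresentable_idBiset [∀ x y : C, Finite (x ⟶ y)] :
    (idBiset C).IsBirepresentable := by
  constructor
  · rw [leftRepresentable_iff]
    intro y
    have aux : ∀ {x : C} (f : y ⟶ x), 𝟙 y ≫ 𝟙 y ≫ f = f := by simp
    refine ⟨Unit, fun _ => y, fun _ => (𝟙 y : y ⟶ y), fun x u => ⟨⟨(), u⟩, aux u, ?_⟩⟩
    rintro ⟨⟨⟩, f⟩ hf
    exact congrArg (Sigma.mk ()) ((aux f).symm.trans hf)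
  · rw [rightRepresentable_iff]
    intro x
    have aux : ∀ {y : C} (f : y ⟶ x), f ≫ 𝟙 x ≫ 𝟙 x = f := by simp
    refine ⟨Unit, fun _ => x, fun _ => (𝟙 x : x ⟶ x), fun y u => ⟨⟨(), u⟩, aux u, ?_⟩⟩
    rintro ⟨⟨⟩, f⟩ hf
    exact congrArg (Sigma.mk ()) ((aux f).symm.trans hf)

/-- The biset attached to a functor with a right adjoint is birepresentable. -/
theorem isBirepresentable_ofFunctor [∀ x y : D, Finite (x ⟶ y)] {G : C ⥤ D} {H : D ⥤ C}
    (adj : G ⊣ H) : (ofFunctor G).IsBirepresentable := by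
  constructor
  · rw [leftRepresentable_iff]
    intro y
    have aux : ∀ {x : D} (f : G.obj y ⟶ x), G.map (𝟙 y) ≫ 𝟙 _ ≫ f = f := by simp
    refine ⟨Unit, fun _ => G.obj y, fun _ => (𝟙 _ : G.obj y ⟶ G.obj y),
      fun x u => ⟨⟨(), u⟩, aux u, ?_⟩⟩
    rintro ⟨⟨⟩, f⟩ hf
    exact congrArg (Sigma.mk ()) ((aux f).symm.trans hf)
  · rw [rightRepresentable_iff]
    intro x
    have aux : ∀ {y : C} (f : y ⟶ H.obj x),
        G.map f ≫ adj.counit.app x ≫ 𝟙 x = (adj.homEquiv y x).symm f := by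
      simp [Adjunction.homEquiv_counit]
    refine ⟨Unit, fun _ => H.obj x, fun _ => (adj.counit.app x : G.obj (H.obj x) ⟶ x),
      fun y u => ⟨⟨(), adj.homEquiv y x u⟩,
        (aux _).trans ((adj.homEquiv y x).symm_apply_apply u), ?_⟩⟩
    rintro ⟨⟨⟩, f⟩ hf
    exact congrArg (Sigma.mk ())
      (((adj.homEquiv y x).symm_apply_eq).1 ((aux f).symm.trans hf))

end Representable

end Biset

/-! ## The category of birepresentable bisets -/

section Grothendieck

variable (R : Type u) [CommRing R]

/-- The birepresentable `(C, D)`-bisets. -/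
abbrev BirepBiset (C D : Type) [SmallCategory C] [SmallCategory D] : Type 1 :=
  {Ω : Biset C D // Ω.IsBirepresentable}

/-- The submodule generated by the elements `Ω - (Ω₁ + Ω₂)` with `Ω ≅ Ω₁ ⊔ Ω₂`. -/
noncomputable def disjUnionRelations (C D : Type) [SmallCategory C] [SmallCategory D] :
    Submodule R (BirepBiset C D →₀ R) :=
  Submodule.span R
    {a | ∃ Ω Ω₁ Ω₂ : BirepBiset C D, Nonempty (Ω.1 ≅ Biset.disjUnion Ω₁.1 Ω₂.1) ∧
      a = Finsupp.single Ω 1 - (Finsupp.single Ω₁ 1 + Finsupp.single Ω₂ 1)}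

/-- The scalar extension to `R` of the Grothendieck group of birepresentable `(C, D)`-bisets with
respect to disjoint union, presented by generators and relations over `R`. -/
def BirepGrothendieck (C D : Type) [SmallCategory C] [SmallCategory D] : Type (max u 1) :=
  (BirepBiset C D →₀ R) ⧸ disjUnionRelations R C D

noncomputable instance (C D : Type) [SmallCategory C] [SmallCategory D] :
    AddCommGroup (BirepGrothendieck R C D) :=
  inferInstanceAs (AddCommGroup ((BirepBiset C D →₀ R) ⧸ disjUnionRelations R C D))

noncomputable instance (C D : Type) [SmallCategory C] [SmallCategory D] :
    Module R (BirepGrothendieck R C D) :=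
  inferInstanceAs (Module R ((BirepBiset C D →₀ R) ⧸ disjUnionRelations R C D))

namespace BirepGrothendieck

variable {C D E F : Type} [SmallCategory C] [SmallCategory D] [SmallCategory E] [SmallCategory F]

/-- The canonical linear map from the free module on the bisets. -/
noncomputable def ofFree : (BirepBiset C D →₀ R) →ₗ[R] BirepGrothendieck R C D :=
  (disjUnionRelations R C D).mkQ

/-- The class of a biset. -/
noncomputable def cls (Ω : BirepBiset C D) : BirepGrothendieck R C D :=
  ofFree R (Finsupp.single Ω 1)

variable {R}

theorem cls_disjUnion {Ω Ω₁ Ω₂ : BirepBiset C D}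
    (i : Nonempty (Ω.1 ≅ Biset.disjUnion Ω₁.1 Ω₂.1)) : cls R Ω = cls R Ω₁ + cls R Ω₂ := by
  rw [cls, cls, cls, ← map_add]
  exact (Submodule.Quotient.eq _).2 (Submodule.subset_span ⟨Ω, Ω₁, Ω₂, i, rfl⟩)

/-- Linear maps out of the Grothendieck group. -/
noncomputable def lift {M : Type w} [AddCommGroup M] [Module R M] (f : BirepBiset C D → M)
    (hf : ∀ Ω Ω₁ Ω₂ : BirepBiset C D, Nonempty (Ω.1 ≅ Biset.disjUnion Ω₁.1 Ω₂.1) →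
      f Ω = f Ω₁ + f Ω₂) : BirepGrothendieck R C D →ₗ[R] M :=
  Submodule.liftQ _ (Finsupp.linearCombination R f) (by
    rw [disjUnionRelations, Submodule.span_le]
    rintro _ ⟨Ω, Ω₁, Ω₂, h, rfl⟩
    simp [hf Ω Ω₁ Ω₂ h])

theorem lift_cls {M : Type w} [AddCommGroup M] [Module R M] (f : BirepBiset C D → M)
    (hf : ∀ Ω Ω₁ Ω₂ : BirepBiset C D, Nonempty (Ω.1 ≅ Biset.disjUnion Ω₁.1 Ω₂.1) →
      f Ω = f Ω₁ + f Ω₂) (Ω : BirepBiset C D) : lift (R := R) f hf (cls R Ω) = f Ω := by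
  change Finsupp.linearCombination R f (Finsupp.single Ω 1) = f Ω
  simp

theorem hom_ext {M : Type w} [AddCommGroup M] [Module R M]
    {f g : BirepGrothendieck R C D →ₗ[R] M} (h : ∀ Ω, f (cls R Ω) = g (cls R Ω)) : f = g := by
  apply Submodule.linearMap_qext (disjUnionRelations R C D)
  apply Finsupp.lhom_ext'
  intro Ω
  ext
  exact h Ω

/-- The empty biset. -/
def emptyBiset (C D : Type) [SmallCategory C] [SmallCategory D] : BirepBiset C D :=
  ⟨Biset.mk' (fun _ _ => Empty) (fun _ _ e => e) (fun e => e.elim) (fun _ _ _ _ e => e.elim), by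
    constructor
    · rw [Biset.leftRepresentable_iff]
      exact fun y => ⟨Empty, Empty.elim, fun i => i.elim, fun x (u : Empty) => u.elim⟩
    · rw [Biset.rightRepresentable_iff]
      exact fun y => ⟨Empty, Empty.elim, fun i => i.elim, fun x (u : Empty) => u.elim⟩⟩

/-- Adding the empty biset does not change a biset. -/
def disjUnionEmpty (Ω : Biset C D) : Ω ≅ Biset.disjUnion Ω (emptyBiset C D).1 :=
  Biset.isoMk (fun x y => (Equiv.sumEmpty (Ω.El x y) Empty).symm) (fun _ _ _ => rfl)

theorem cls_empty : cls R (emptyBiset C D) = 0 := by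
  have h := cls_disjUnion (R := R) (Ω := emptyBiset C D) ⟨disjUnionEmpty (emptyBiset C D).1⟩
  simpa using h

theorem cls_eq_of_iso {Ω Ψ : BirepBiset C D} (i : Nonempty (Ω.1 ≅ Ψ.1)) :
    cls R Ω = cls R Ψ := by
  obtain ⟨i⟩ := i
  have h := cls_disjUnion (R := R) (Ω := Ω) (Ω₁ := Ψ) (Ω₂ := emptyBiset C D)
    ⟨i ≪≫ disjUnionEmpty Ψ.1⟩
  rwa [cls_empty, add_zero] at h

/-- The composite of birepresentable bisets. -/
def _root_.BirepBiset.comp [Finite D] (Ω : BirepBiset C D) (Ψ : BirepBiset D E) :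
    BirepBiset C E :=
  ⟨Ω.1.comp Ψ.1, Ω.2.comp Ψ.2⟩

/-- The `R`-bilinear extension of the composition of bisets. -/
noncomputable def comp [Finite D] :
    BirepGrothendieck R C D →ₗ[R] BirepGrothendieck R D E →ₗ[R] BirepGrothendieck R C E :=
  lift (fun Ω => lift (fun Ψ => cls R (Ω.comp Ψ)) (by
      rintro Ψ Ψ₁ Ψ₂ ⟨i⟩
      exact cls_disjUnion
        ⟨Biset.compCongr (Iso.refl _) i ≪≫ Biset.compDisjUnion Ω.1 Ψ₁.1 Ψ₂.1⟩)) (by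
    rintro Ω Ω₁ Ω₂ ⟨i⟩
    apply hom_ext
    intro Ψ
    simp only [LinearMap.add_apply, lift_cls]
    exact cls_disjUnion
      ⟨Biset.compCongr i (Iso.refl _) ≪≫ Biset.disjUnionComp Ω₁.1 Ω₂.1 Ψ.1⟩)

theorem comp_cls [Finite D] (Ω : BirepBiset C D) (Ψ : BirepBiset D E) :
    comp (cls R Ω) (cls R Ψ) = cls R (Ω.comp Ψ) := by
  rw [comp, lift_cls, lift_cls]

theorem induction {p : BirepGrothendieck R C D → Prop} (hcls : ∀ Ω, p (cls R Ω))
    (hadd : ∀ a b, p a → p b → p (a + b)) (hsmul : ∀ (r : R) a, p a → p (r • a))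
    (a : BirepGrothendieck R C D) : p a := by
  obtain ⟨a, rfl⟩ : ∃ b, ofFree R b = a := Submodule.mkQ_surjective _ a
  induction a using Finsupp.induction_linear with
  | zero =>
    have h := hsmul 0 _ (hcls (emptyBiset C D))
    rw [zero_smul] at h
    rw [map_zero]
    exact h
  | add a b ha hb =>
    rw [map_add]
    exact hadd _ _ ha hb
  | single Ω r =>
    have h := hsmul r _ (hcls Ω)
    rw [cls, ← map_smul, Finsupp.smul_single, smul_eq_mul, mul_one] at h
    exact h

theorem comp_assoc [Finite D] [Finite E] (a : BirepGrothendieck R C D)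
    (b : BirepGrothendieck R D E) (c : BirepGrothendieck R E F) :
    comp (comp a b) c = comp a (comp b c) := by
  induction a using induction with
  | hadd a a' h h' => simp only [map_add, LinearMap.add_apply, h, h']
  | hsmul r a h => simp only [map_smul, LinearMap.smul_apply, h]
  | hcls Ω =>
    induction b using induction with
    | hadd a a' h h' => simp only [map_add, LinearMap.add_apply, h, h']
    | hsmul r a h => simp only [map_smul, LinearMap.smul_apply, h]
    | hcls Ψ =>
      induction c using induction with
      | hadd a a' h h' => simp only [map_add, h, h']
      | hsmul r a h => simp only [map_smul, h]
      | hcls Θ =>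
        rw [comp_cls, comp_cls, comp_cls, comp_cls]
        exact cls_eq_of_iso ⟨Biset.compAssoc Ω.1 Ψ.1 Θ.1⟩

theorem comp_add' [Finite D] (a : BirepGrothendieck R C D) (b b' : BirepGrothendieck R D E) :
    comp a (b + b') = comp a b + comp a b' := map_add _ _ _

theorem add_comp' [Finite D] (a a' : BirepGrothendieck R C D) (b : BirepGrothendieck R D E) :
    comp (a + a') b = comp a b + comp a' b := by
  rw [map_add, LinearMap.add_apply]

theorem comp_smul' [Finite D] (r : R) (a : BirepGrothendieck R C D)
    (b : BirepGrothendieck R D E) : comp a (r • b) = r • comp a b := map_smul _ _ _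

theorem smul_comp' [Finite D] (r : R) (a : BirepGrothendieck R C D)
    (b : BirepGrothendieck R D E) : comp (r • a) b = r • comp a b := by
  rw [map_smul, LinearMap.smul_apply]

/-- The class of the identity biset. -/
noncomputable def one (C : Type) [SmallCategory C] [∀ x y : C, Finite (x ⟶ y)] : BirepGrothendieck R C C :=
  cls R ⟨Biset.idBiset C, Biset.isBirepresentable_idBiset⟩

theorem one_comp [Finite C] [∀ x y : C, Finite (x ⟶ y)] (a : BirepGrothendieck R C D) :
    comp (one C) a = a := by
  induction a using induction with
  | hadd a a' h h' => simp only [map_add, h, h']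
  | hsmul r a h => simp only [map_smul, h]
  | hcls Ω =>
    rw [one, comp_cls]
    exact cls_eq_of_iso ⟨Biset.idComp Ω.1⟩

theorem comp_one [Finite D] [∀ x y : D, Finite (x ⟶ y)] (a : BirepGrothendieck R C D) :
    comp a (one D) = a := by
  induction a using induction with
  | hadd a a' h h' => simp only [map_add, LinearMap.add_apply, h, h']
  | hsmul r a h => simp only [map_smul, LinearMap.smul_apply, h]
  | hcls Ω =>
    rw [one, comp_cls]
    exact cls_eq_of_iso ⟨Biset.compId Ω.1⟩

end BirepGrothendieck

end Grothendieck

/-- The objects of the biset category `𝔹¹,¹` over `R`: the finite categories. -/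
structure BirepBisetCat (R : Type u) : Type 1 where
  /-- the underlying type of objects -/
  carrier : Type
  [category : SmallCategory carrier]
  [finite_obj : Finite carrier]
  [finite_hom : ∀ x y : carrier, Finite (x ⟶ y)]

namespace BirepBisetCat

attribute [instance] category finite_obj finite_hom

variable (R : Type u) [CommRing R]

/-- The biset category `𝔹¹,¹`: a morphism from `C` to `D` is an `R`-linear combination of
birepresentable `(D, C)`-bisets. -/
noncomputable instance : Category.{max u 1} (BirepBisetCat R) where
  Hom C D := BirepGrothendieck R D.carrier C.carrier
  id C := BirepGrothendieck.one C.carrier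
  comp f g := BirepGrothendieck.comp g f
  id_comp f := BirepGrothendieck.comp_one f
  comp_id f := BirepGrothendieck.one_comp f
  assoc f g h := (BirepGrothendieck.comp_assoc h g f).symm

noncomputable instance (C D : BirepBisetCat R) : AddCommGroup (C ⟶ D) :=
  inferInstanceAs (AddCommGroup (BirepGrothendieck R D.carrier C.carrier))

noncomputable instance (C D : BirepBisetCat R) : Module R (C ⟶ D) :=
  inferInstanceAs (Module R (BirepGrothendieck R D.carrier C.carrier))

theorem add_comp_hom {P Q S : BirepBisetCat R} (f f' : P ⟶ Q) (g : Q ⟶ S) :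
    (f + f') ≫ g = f ≫ g + f' ≫ g :=
  BirepGrothendieck.comp_add' (R := R) (C := S.carrier) (D := Q.carrier) (E := P.carrier) g f f'

theorem comp_add_hom {P Q S : BirepBisetCat R} (f : P ⟶ Q) (g g' : Q ⟶ S) :
    f ≫ (g + g') = f ≫ g + f ≫ g' :=
  BirepGrothendieck.add_comp' (R := R) (C := S.carrier) (D := Q.carrier) (E := P.carrier) g g' f

theorem smul_comp_hom {P Q S : BirepBisetCat R} (r : R) (f : P ⟶ Q) (g : Q ⟶ S) :
    (r • f) ≫ g = r • f ≫ g :=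
  BirepGrothendieck.comp_smul' (R := R) (C := S.carrier) (D := Q.carrier) (E := P.carrier) r g f

theorem comp_smul_hom {P Q S : BirepBisetCat R} (f : P ⟶ Q) (r : R) (g : Q ⟶ S) :
    f ≫ (r • g) = r • f ≫ g :=
  BirepGrothendieck.smul_comp' (R := R) (C := S.carrier) (D := Q.carrier) (E := P.carrier) r g f

noncomputable instance : Preadditive (BirepBisetCat R) where
  homGroup _ _ := inferInstance
  add_comp _ _ _ f f' g := add_comp_hom R f f' g
  comp_add _ _ _ f g g' := comp_add_hom R f g g'

noncomputable instance : Linear R (BirepBisetCat R) where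
  homModule _ _ := inferInstance
  smul_comp _ _ _ r f g := smul_comp_hom R r f g
  comp_smul _ _ _ f r g := comp_smul_hom R f r g

end BirepBisetCat

/-! ## Correspondences -/

/-- The objects of the category of correspondences: the finite sets. -/
structure Corresp : Type 1 where
  /-- the underlying set -/
  carrier : Type
  [finite : Finite carrier]

namespace Corresp

attribute [instance] finite

/-- A correspondence from `X` to `Y`: a subset of `Y × X`. -/
@[ext]
structure Hom (X Y : Corresp) : Type where
  /-- the underlying subset -/
  rel : Set (Y.carrier × X.carrier)

/-- The category of correspondences. The composite `U V` of `V ⊆ Y × X` and `U ⊆ Z × Y` is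
`{(z, x) | ∃ y, (z, y) ∈ U ∧ (y, x) ∈ V}`. -/
instance : Category Corresp where
  Hom := Hom
  id X := ⟨{p | p.1 = p.2}⟩
  comp V U := ⟨{p | ∃ y, (p.1, y) ∈ U.rel ∧ (y, p.2) ∈ V.rel}⟩
  id_comp U := by
    apply Hom.ext
    ext ⟨y, x⟩
    simp
  comp_id U := by
    apply Hom.ext
    ext ⟨y, x⟩
    simp
  assoc U V W := by
    apply Hom.ext
    ext ⟨y, x⟩
    constructor
    · rintro ⟨a, h₁, b, h₂, h₃⟩
      exact ⟨b, ⟨a, h₁, h₂⟩, h₃⟩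
    · rintro ⟨b, ⟨a, h₁, h₂⟩, h₃⟩
      exact ⟨a, h₁, b, h₂, h₃⟩

variable {X Y Z : Corresp}

/-- The map `2^X → 2^Y` sending `A` to `{y | ∃ (y, x) ∈ U, x ∈ A}`. -/
def image (U : X ⟶ Y) (A : Set X.carrier) : Set Y.carrier :=
  {y | ∃ x ∈ A, (y, x) ∈ U.rel}

theorem image_mono (U : X ⟶ Y) : Monotone (image U) :=
  fun _ _ h _ ⟨x, hx, hy⟩ => ⟨x, h hx, hy⟩

/-- The map `A ↦ {y | ∃ (y, x) ∈ U, x ∈ A}`, as a functor between posets. -/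
def imageFunctor (U : X ⟶ Y) : Set X.carrier ⥤ Set Y.carrier :=
  (image_mono U).functor

theorem gc_image (U : X ⟶ Y) :
    GaloisConnection (image U) (fun B => {x | ∀ y, (y, x) ∈ U.rel → y ∈ B}) := by
  intro A B
  constructor
  · intro h x hx y hy
    exact h ⟨x, hx, hy⟩
  · rintro h y ⟨x, hx, hy⟩
    exact h hx y hy

theorem image_id (A : Set X.carrier) : image (𝟙 X) A = A := by
  ext x
  constructor
  · rintro ⟨y, hy, h⟩
    have h' : x = y := h
    exact h' ▸ hy
  · intro hx
    exact ⟨x, hx, rfl⟩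

theorem image_comp (U : X ⟶ Y) (V : Y ⟶ Z) (A : Set X.carrier) :
    image (U ≫ V) A = image V (image U A) := by
  ext z
  constructor
  · rintro ⟨x, hx, y, hzy, hyx⟩
    exact ⟨y, ⟨x, hx, hyx⟩, hzy⟩
  · rintro ⟨y, ⟨x, hx, hyx⟩, hzy⟩
    exact ⟨x, hx, y, hzy, hyx⟩

theorem imageFunctor_id : imageFunctor (𝟙 X) = 𝟭 (Set X.carrier) :=
  CategoryTheory.Functor.ext image_id (fun _ _ _ => Subsingleton.elim _ _)

theorem imageFunctor_comp (U : X ⟶ Y) (V : Y ⟶ Z) :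
    imageFunctor (U ≫ V) = imageFunctor U ⋙ imageFunctor V :=
  CategoryTheory.Functor.ext (image_comp U V) (fun _ _ _ => Subsingleton.elim _ _)

/-- The biset attached to a correspondence `U ⊆ Y × X`; its value at `(B, A)` is the set of
morphisms in `2^Y` from `{y | ∃ (y, x) ∈ U, x ∈ A}` to `B`. -/
def biset (U : X ⟶ Y) : BirepBiset (Set Y.carrier) (Set X.carrier) :=
  ⟨Biset.ofFunctor (imageFunctor U), Biset.isBirepresentable_ofFunctor (gc_image U).adjunction⟩

variable (R : Type u) [CommRing R]

/-- The poset `2^X` of subsets of `X`, as an object of `𝔹¹,¹`. -/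
def boolean (X : Corresp) : BirepBisetCat R where
  carrier := Set X.carrier

/-- The functor from correspondences to `𝔹¹,¹` sending `X` to `2^X` and `U` to its biset. -/
noncomputable def toBiset : Corresp ⥤ BirepBisetCat R where
  obj X := boolean R X
  map U := BirepGrothendieck.cls R (biset U)
  map_id X := BirepGrothendieck.cls_eq_of_iso ⟨eqToIso (by
    change Biset.ofFunctor (imageFunctor (𝟙 X)) = Biset.ofFunctor (𝟭 (Set X.carrier))
    rw [imageFunctor_id]) ≪≫ Biset.ofFunctorId⟩
  map_comp U V := (BirepGrothendieck.cls_eq_of_iso ⟨eqToIso (by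
    change Biset.ofFunctor (imageFunctor (U ≫ V)) =
      Biset.ofFunctor (imageFunctor U ⋙ imageFunctor V)
    rw [imageFunctor_comp]) ≪≫ Biset.ofFunctorComp _ _⟩).trans
      (BirepGrothendieck.comp_cls (biset V) (biset U)).symm

/-- The full subcategory of `𝔹¹,¹` whose objects are the posets `2^X`. -/
abbrev BooleanCat : Type 1 :=
  (ObjectProperty.ofObj (boolean R)).FullSubcategory

/-- The functor from correspondences to the full subcategory of the posets `2^X`. -/
noncomputable def toBoolean : Corresp ⥤ BooleanCat R :=
  ObjectProperty.lift _ (toBiset R) (fun X => ⟨X⟩)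

end Corresp

/-! ## Simple functors and composition factors -/

section Simple

variable {R : Type u} [CommRing R]

/-- The simple correspondence functors over `R`. -/
def simpleCorresp (R : Type u) [CommRing R] :
    ObjectProperty (Corresp ⥤ ModuleCat.{max u 1} R) :=
  fun T => Simple T

/-- The simple `R`-linear functors on `𝓑` that do not vanish on all the objects `J X`. A subfunctor
of an `R`-linear functor is again `R`-linear, so simplicity may be tested among all functors. -/
def simpleNonvanishing (R : Type u) [CommRing R] {𝓑 : Type u₁} [Category.{v₁} 𝓑] [Preadditive 𝓑]
    [Linear R 𝓑] (J : Corresp ⥤ 𝓑) : ObjectProperty (𝓑 ⥤ ModuleCat.{max u 1} R) :=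
  fun S => S.Additive ∧ S.Linear R ∧ Simple S ∧ ∃ X : Corresp, Nontrivial (S.obj (J.obj X))

/-- `X` is a finite set of smallest size such that `T(X) ≠ 0`. -/
def IsMinimalSet (T : Corresp ⥤ ModuleCat.{v} R) (X : Corresp) : Prop :=
  Nontrivial (T.obj X) ∧
    ∀ Z : Corresp, Nat.card Z.carrier < Nat.card X.carrier → Subsingleton (T.obj Z)

open Limits in
/-- `T` is isomorphic to the quotient `N / M` of the subfunctors `M ≤ N` of `F`. -/
def IsSubquotient {F : Corresp ⥤ ModuleCat.{max u 1} R} {M N : Subobject F} (h : M ≤ N)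
    (T : Corresp ⥤ ModuleCat.{max u 1} R) : Prop :=
  Nonempty (cokernel (Subobject.ofLE M N h) ≅ T)

/-- `T` is a composition factor of `F`: a simple subquotient. -/
def IsCompositionFactor (F T : Corresp ⥤ ModuleCat.{max u 1} R) : Prop :=
  Simple T ∧ ∃ (M N : Subobject F) (h : M ≤ N), IsSubquotient h T

/-- `T` is a composition factor of `F` for which `X` is a smallest set with `T(X) ≠ 0`. -/
def IsFactorAt (F T : Corresp ⥤ ModuleCat.{max u 1} R) (X : Corresp) : Prop :=
  IsCompositionFactor F T ∧ IsMinimalSet T X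

/-- `T` is the unique composition factor of `F` for which `X` is a smallest set with `T(X) ≠ 0`:
any other one is isomorphic to `T`, and `T` occurs only once, in the sense that there are no
subfunctors `M₁ ≤ N₁ ≤ M₂ ≤ N₂` of `F` with `N₁ / M₁` and `N₂ / M₂` both isomorphic to `T`. -/
def IsUniqueFactorAt (F T : Corresp ⥤ ModuleCat.{max u 1} R) (X : Corresp) : Prop :=
  IsFactorAt F T X ∧
    (∀ T' : Corresp ⥤ ModuleCat.{max u 1} R, IsFactorAt F T' X → Nonempty (T' ≅ T)) ∧
    ∀ (M₁ N₁ M₂ N₂ : Subobject F) (h₁ : M₁ ≤ N₁) (_ : N₁ ≤ M₂) (h₂ : M₂ ≤ N₂),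
      ¬ (IsSubquotient h₁ T ∧ IsSubquotient h₂ T)

/-- The values of `F` and `T` at `X` are isomorphic as modules over the algebra of
correspondences on `X`. -/
def SameEvaluation (F T : Corresp ⥤ ModuleCat.{max u 1} R) (X : Corresp) : Prop :=
  ∃ e : F.obj X ≅ T.obj X, ∀ U : X ⟶ X, F.map U ≫ e.hom = e.hom ≫ T.map U

/-- The isomorphism classes of the objects with property `P`. -/
abbrev IsoClasses {𝓒 : Type u₁} [Category.{v₁} 𝓒] (P : ObjectProperty 𝓒) :=
  Quotient (isIsomorphicSetoid P.FullSubcategory)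

/-- The isomorphism class of an object with property `P`. -/
def isoClass {𝓒 : Type u₁} [Category.{v₁} 𝓒] {P : ObjectProperty 𝓒} (A : P.FullSubcategory) :
    IsoClasses P :=
  Quotient.mk _ A

end Simple

/-! Everything is decided by values at a smallest set. A simple functor is determined, up to
isomorphism, by its value at any one object where it is nonzero, as a module for the endomorphisms
of that object (`nonempty_iso_of_simple`). So it suffices to compare endomorphisms of `2^X` with
correspondences on `X`, as far as they act on functors vanishing on all smaller sets.

The comparison is `ReducesToCorresp`: modulo endomorphisms factoring through some `2^Z` with `|Z| <
|X|`, every endomorphism of `2^X` is a combination of correspondences, and the only new relations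
among these come from correspondences that already factor through a smaller set. Given this, let `S`
be simple and `X` smallest with `S(2^X) ≠ 0`. Morphisms through smaller sets act as zero, so
`S(2^X)` is a simple module for the correspondences on `X` (`ReducesToCorresp.orbit_comp_eq_top`). A
subfunctor of `Ŝ` is then zero or everything at `X`, so a subquotient that is nonzero at `X` takes
the whole value there. This gives existence, uniqueness and multiplicity one of `T`. Conversely, for
a simple `T` with smallest set `X`, the module `T(X)` is killed by what factors through smaller
sets, hence is a module for `End(2^X)`. The subfunctor generated at `2^X` inside the coinduced
functor is a simple `S` with this value (`ReducesToCorresp.exists_simpleNonvanishing`).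

To prove the comparison for bisets, note that the full subset is terminal and `∅` is initial in the
posets concerned. A birepresentable biset therefore splits into pieces indexed by its value at
`(Set.univ, ∅)`, and each piece has at most one element at each place. Such a piece is a relation `W
B A` whose nonempty columns are principal up-sets and whose nonempty rows are principal down-sets.
If it is defined for all `A` and relates `∅` to `∅`, it is a correspondence
(`IsThin.exists_corresp`); otherwise it factors through a proper subset (`IsThin.factor_right`,
`IsThin.factor_left`). If a composite of two such relations is a correspondence, that correspondence
factors through the same middle set (`exists_factorization`). Reading off the correspondences among
the pieces is thus the required projection. -/

namespace ModuleFunctor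

open Limits

variable {R : Type u} [CommRing R] {𝓑 : Type u₁} [Category.{v₁} 𝓑]

/-! ## Subfunctors generated by elements -/

/-- The subfunctor given by a stable family of submodules. -/
def sub (F : 𝓑 ⥤ ModuleCat.{w} R) (N : ∀ c, Submodule R (F.obj c))
    (hN : ∀ {c d : 𝓑} (f : c ⟶ d), ∀ x ∈ N c, (F.map f).hom x ∈ N d) : 𝓑 ⥤ ModuleCat.{w} R where
  obj c := ModuleCat.of R (N c)
  map f := ModuleCat.ofHom ((F.map f).hom.restrict (hN f))
  map_id c := by
    ext x
    simp [LinearMap.restrict_apply]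
  map_comp f g := by
    ext x
    simp [LinearMap.restrict_apply]

section sub

variable (F : 𝓑 ⥤ ModuleCat.{w} R) (N : ∀ c, Submodule R (F.obj c))
    (hN : ∀ {c d : 𝓑} (f : c ⟶ d), ∀ x ∈ N c, (F.map f).hom x ∈ N d)

/-- The inclusion of the subfunctor given by a stable family of submodules. -/
def subι : sub F N hN ⟶ F where
  app c := ModuleCat.ofHom (N c).subtype
  naturality c d f := by
    ext x
    rfl

instance : Mono (subι F N hN) := by
  have : ∀ c, Mono ((subι F N hN).app c) := fun c =>
    (ModuleCat.mono_iff_injective _).2 (fun _ _ h => Subtype.ext h)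
  exact NatTrans.mono_of_mono_app _

theorem range_subι (c : 𝓑) : LinearMap.range ((subι F N hN).app c).hom = N c :=
  Submodule.range_subtype _

end sub

/-- The values at `c` of the subfunctor of `F` generated by elements of `F(b)`. -/
def orbit (F : 𝓑 ⥤ ModuleCat.{w} R) {b : 𝓑} (A : Set (F.obj b)) (c : 𝓑) :
    Submodule R (F.obj c) :=
  Submodule.span R {y | ∃ (f : b ⟶ c), ∃ x ∈ A, (F.map f).hom x = y}

theorem map_mem_orbit (F : 𝓑 ⥤ ModuleCat.{w} R) {b c : 𝓑} {A : Set (F.obj b)} (f : b ⟶ c)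
    {x : F.obj b} (hx : x ∈ A) : (F.map f).hom x ∈ orbit F A c :=
  Submodule.subset_span ⟨f, x, hx, rfl⟩

theorem mem_orbit_self (F : 𝓑 ⥤ ModuleCat.{w} R) {b : 𝓑} {A : Set (F.obj b)}
    {x : F.obj b} (hx : x ∈ A) : x ∈ orbit F A b := by
  simpa using map_mem_orbit F (𝟙 b) hx

theorem orbit_le {F : 𝓑 ⥤ ModuleCat.{w} R} {b c : 𝓑} {A : Set (F.obj b)}
    {P : Submodule R (F.obj c)} (h : ∀ (f : b ⟶ c), ∀ x ∈ A, (F.map f).hom x ∈ P) :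
    orbit F A c ≤ P :=
  Submodule.span_le.2 (by rintro _ ⟨f, x, hx, rfl⟩; exact h f x hx)

theorem orbit_singleton_le {F : 𝓑 ⥤ ModuleCat.{w} R} {b c : 𝓑} {x : F.obj b}
    {P : Submodule R (F.obj c)} (h : ∀ f : b ⟶ c, (F.map f).hom x ∈ P) : orbit F {x} c ≤ P :=
  orbit_le (by rintro f _ rfl; exact h f)

theorem map_orbit (F : 𝓑 ⥤ ModuleCat.{w} R) {b : 𝓑} (A : Set (F.obj b)) {c d : 𝓑}
    (f : c ⟶ d) (x : F.obj c) (hx : x ∈ orbit F A c) : (F.map f).hom x ∈ orbit F A d := by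
  have h : orbit F A c ≤ (orbit F A d).comap (F.map f).hom := orbit_le (by
    intro g x hx
    have := map_mem_orbit F (g ≫ f) hx
    simpa using this)
  exact h hx

/-! ## Simple functors -/

theorem nontrivial_of_simple (F : 𝓑 ⥤ ModuleCat.{w} R) [Simple F] :
    ∃ b, Nontrivial (F.obj b) := by
  by_contra! h
  apply id_nonzero F
  ext c x
  have := h c
  exact Subsingleton.elim _ _

/-- The inclusion of the generated subfunctor is a nonzero monomorphism into a simple object, hence
an isomorphism, and surjectivity can be read off at each object. -/
theorem orbit_eq_top (F : 𝓑 ⥤ ModuleCat.{w} R) [Simple F] {b : 𝓑} {x : F.obj b} (hx : x ≠ 0)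
    (c : 𝓑) : orbit F {x} c = ⊤ := by
  have hne : subι F (orbit F {x}) (map_orbit F {x}) ≠ 0 := by
    intro h
    apply hx
    have h₁ := congrArg (fun t => (t.app b).hom ⟨x, mem_orbit_self F rfl⟩) h
    exact h₁
  have := isIso_of_mono_of_nonzero hne
  rw [← range_subι F (orbit F {x}) (map_orbit F {x}) c, LinearMap.range_eq_top]
  have h : Function.Bijective ((subι F (orbit F {x}) (map_orbit F {x})).app c) :=
    ConcreteCategory.bijective_of_isIso _
  exact h.2

/-- The image of a nonzero monomorphism contains a nonzero element, hence everything that element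
generates. This converse of `orbit_eq_top` is the working criterion for simplicity. -/
theorem simple_of_orbit_eq_top (F : 𝓑 ⥤ ModuleCat.{w} R) (hF : ∃ b, Nontrivial (F.obj b))
    (h : ∀ (b : 𝓑) (x : F.obj b), x ≠ 0 → ∀ c, orbit F {x} c = ⊤) : Simple F where
  mono_isIso_iff_nonzero {Y} f _ := by
    constructor
    · rintro hf rfl
      obtain ⟨b, hb⟩ := hF
      obtain ⟨x, hx⟩ := exists_ne (0 : F.obj b)
      have h₁ : Function.Bijective ((0 : Y ⟶ F).app b) := ConcreteCategory.bijective_of_isIso _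
      obtain ⟨y, hy⟩ := h₁.2 x
      exact hx (hy.symm.trans rfl)
    · intro hf
      obtain ⟨b, y, hy⟩ : ∃ (b : 𝓑) (y : Y.obj b), (f.app b).hom y ≠ 0 := by
        by_contra! h₁
        apply hf
        ext b y
        exact h₁ b y
      have hiso : ∀ c, IsIso (f.app c) := by
        intro c
        rw [ConcreteCategory.isIso_iff_bijective]
        refine ⟨(ModuleCat.mono_iff_injective _).1 inferInstance, ?_⟩
        have h₁ : orbit F {(f.app b).hom y} c ≤ LinearMap.range (f.app c).hom := orbit_le (by
          rintro g _ rfl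
          refine ⟨(Y.map g).hom y, ?_⟩
          exact ConcreteCategory.congr_hom (f.naturality g) y)
        rw [h b _ hy c, top_le_iff, LinearMap.range_eq_top] at h₁
        exact h₁
      exact NatIso.isIso_of_isIso_app f

/-- If every map to `b` killed `y`, the subfunctor generated by `y` would vanish at `b`, although it
is all of `F`. -/
theorem exists_map_ne_zero (F : 𝓑 ⥤ ModuleCat.{w} R) [Simple F] {b c : 𝓑}
    [Nontrivial (F.obj b)] {y : F.obj c} (hy : y ≠ 0) : ∃ g : c ⟶ b, (F.map g).hom y ≠ 0 := by
  by_contra! h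
  have h₁ : orbit F {y} b ≤ ⊥ := orbit_le (by rintro g _ rfl; exact h g)
  rw [orbit_eq_top F hy b, top_le_iff] at h₁
  exact top_ne_bot h₁.symm

/-! ### Isomorphisms of simple functors from an isomorphism of values -/

section iso

variable {F G : 𝓑 ⥤ ModuleCat.{w} R} {b : 𝓑} (e : F.obj b →ₗ[R] G.obj b)

/-- The subfunctor of `F × G` generated by the graph of a linear map between values. -/
def graph (c : 𝓑) : Submodule R (F.obj c × G.obj c) :=
  Submodule.span R {p | ∃ (f : b ⟶ c) (x : F.obj b), p = ((F.map f).hom x, (G.map f).hom (e x))}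

theorem map_graph {c d : 𝓑} (f : c ⟶ d) {p : F.obj c × G.obj c} (hp : p ∈ graph e c) :
    ((F.map f).hom p.1, (G.map f).hom p.2) ∈ graph e d := by
  have h : graph e c ≤ (graph e d).comap ((F.map f).hom.prodMap (G.map f).hom) := by
    refine Submodule.span_le.2 ?_
    rintro _ ⟨g, x, rfl⟩
    refine Submodule.subset_span ⟨g ≫ f, x, ?_⟩
    simp
  exact h hp

/-- Equivariance of `e` says that its graph is already stable under endomorphisms of `b`, so
generating a subfunctor adds nothing at `b`. -/
theorem graph_self (he : ∀ (f : b ⟶ b) (x : F.obj b), e ((F.map f).hom x) = (G.map f).hom (e x))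
    {p : F.obj b × G.obj b} (hp : p ∈ graph e b) : p.2 = e p.1 := by
  have h : graph e b ≤ LinearMap.ker (LinearMap.snd R _ _ - e ∘ₗ LinearMap.fst R _ _) := by
    refine Submodule.span_le.2 ?_
    rintro _ ⟨g, x, rfl⟩
    simp [he]
  have h₁ := h hp
  simpa [sub_eq_zero] using h₁

/-- A pair `(0, y)` with `y ≠ 0` could be moved to `b` with `y` still nonzero, but there the
subfunctor is the graph of `e`. -/
theorem graph_snd_eq_zero [Simple G] [Nontrivial (G.obj b)]
    (he : ∀ (f : b ⟶ b) (x : F.obj b), e ((F.map f).hom x) = (G.map f).hom (e x))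
    {c : 𝓑} {p : F.obj c × G.obj c} (hp : p ∈ graph e c) (h : p.1 = 0) : p.2 = 0 := by
  by_contra h₂
  obtain ⟨g, hg⟩ := exists_map_ne_zero G (b := b) h₂
  have h₃ := graph_self e he (map_graph e g hp)
  apply hg
  simpa [h] using h₃

theorem graph_fst_eq_zero [Simple F] [Nontrivial (F.obj b)] (hinj : Function.Injective e)
    (he : ∀ (f : b ⟶ b) (x : F.obj b), e ((F.map f).hom x) = (G.map f).hom (e x))
    {c : 𝓑} {p : F.obj c × G.obj c} (hp : p ∈ graph e c) (h : p.2 = 0) : p.1 = 0 := by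
  by_contra h₂
  obtain ⟨g, hg⟩ := exists_map_ne_zero F (b := b) h₂
  have h₃ := graph_self e he (map_graph e g hp)
  apply hg
  apply hinj
  simpa [h] using h₃.symm

theorem graph_fst_surjective [Simple F] [Nontrivial (F.obj b)] (c : 𝓑) (x : F.obj c) :
    ∃ p ∈ graph e c, p.1 = x := by
  obtain ⟨x₀, hx₀⟩ := exists_ne (0 : F.obj b)
  have h : orbit F {x₀} c ≤ (graph e c).map (LinearMap.fst R _ _) := orbit_le (by
    rintro f _ rfl
    exact ⟨_, Submodule.subset_span ⟨f, _, rfl⟩, rfl⟩)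
  rw [orbit_eq_top F hx₀ c] at h
  exact h (Submodule.mem_top (x := x))

theorem graph_snd_surjective [Simple G] [Nontrivial (G.obj b)]
    (hsurj : Function.Surjective e) (c : 𝓑) (y : G.obj c) :
    ∃ p ∈ graph e c, p.2 = y := by
  obtain ⟨y₀, hy₀⟩ := exists_ne (0 : G.obj b)
  obtain ⟨x₀, rfl⟩ := hsurj y₀
  have h : orbit G {e x₀} c ≤ (graph e c).map (LinearMap.snd R _ _) := orbit_le (by
    rintro f _ rfl
    exact ⟨_, Submodule.subset_span ⟨f, _, rfl⟩, rfl⟩)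
  rw [orbit_eq_top G hy₀ c] at h
  exact h (Submodule.mem_top (x := y))

/-- Two simple functors with isomorphic nonzero values at an object, as modules for its
endomorphisms, are isomorphic. -/
theorem nonempty_iso_of_simple [Simple F] [Simple G] [Nontrivial (F.obj b)]
    [Nontrivial (G.obj b)] (hbij : Function.Bijective e)
    (he : ∀ (f : b ⟶ b) (x : F.obj b), e ((F.map f).hom x) = (G.map f).hom (e x)) :
    Nonempty (F ≅ G) := by
  -- Both projections from the subfunctor generated by the graph of `e` turn out to be bijective at
  -- every object, so this subfunctor is itself the graph of the isomorphism sought.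
  let p₁ : ∀ c, graph e c →ₗ[R] F.obj c := fun c => LinearMap.fst R _ _ ∘ₗ (graph e c).subtype
  let p₂ : ∀ c, graph e c →ₗ[R] G.obj c := fun c => LinearMap.snd R _ _ ∘ₗ (graph e c).subtype
  have h₁ : ∀ c, Function.Bijective (p₁ c) := by
    intro c
    refine ⟨?_, fun x => ?_⟩
    · rw [← LinearMap.ker_eq_bot, LinearMap.ker_eq_bot']
      rintro ⟨p, hp⟩ h
      exact Subtype.ext (Prod.ext h (graph_snd_eq_zero e he hp h))
    · obtain ⟨p, hp, h⟩ := graph_fst_surjective e c x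
      exact ⟨⟨p, hp⟩, h⟩
  have h₂ : ∀ c, Function.Bijective (p₂ c) := by
    intro c
    refine ⟨?_, fun x => ?_⟩
    · rw [← LinearMap.ker_eq_bot, LinearMap.ker_eq_bot']
      rintro ⟨p, hp⟩ h
      exact Subtype.ext (Prod.ext (graph_fst_eq_zero e hbij.1 he hp h) h)
    · obtain ⟨p, hp, h⟩ := graph_snd_surjective e hbij.2 c x
      exact ⟨⟨p, hp⟩, h⟩
  let e₁ := fun c => LinearEquiv.ofBijective (p₁ c) (h₁ c)
  let e₂ := fun c => LinearEquiv.ofBijective (p₂ c) (h₂ c)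
  refine ⟨NatIso.ofComponents (fun c => ((e₁ c).symm ≪≫ₗ e₂ c).toModuleIso) ?_⟩
  intro c d f
  ext x
  obtain ⟨p, rfl⟩ := (e₁ c).surjective x
  have h₃ : (e₁ d).symm ((F.map f).hom (e₁ c p)) = ⟨_, map_graph e f p.2⟩ := by
    rw [LinearEquiv.symm_apply_eq]
    rfl
  change e₂ d ((e₁ d).symm ((F.map f).hom (e₁ c p))) =
    (G.map f).hom (e₂ c ((e₁ c).symm (e₁ c p)))
  rw [h₃, LinearEquiv.symm_apply_apply]
  rfl

end iso

end ModuleFunctor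

namespace ModuleFunctor

open Limits

variable {R : Type u} [CommRing R] {𝓑 : Type u₁} [Category.{v₁} 𝓑]

theorem orbit_map {F G : 𝓑 ⥤ ModuleCat.{w} R} (η : F ⟶ G) {b : 𝓑} (x : F.obj b) (c : 𝓑) :
    (orbit F {x} c).map (η.app c).hom = orbit G {(η.app b).hom x} c := by
  have nat : ∀ f : b ⟶ c, (η.app c).hom ((F.map f).hom x) = (G.map f).hom ((η.app b).hom x) :=
    fun f => ConcreteCategory.congr_hom (η.naturality f) x
  apply le_antisymm
  · rw [Submodule.map_le_iff_le_comap]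
    refine orbit_le ?_
    rintro f _ rfl
    rw [Submodule.mem_comap, nat]
    exact map_mem_orbit G f rfl
  · refine orbit_le ?_
    rintro f _ rfl
    exact ⟨_, map_mem_orbit F f rfl, nat f⟩

/-- An element generates the same subfunctor inside `sub F N hN` as inside `F`, so the simplicity
criterion can be checked in `F`. -/
theorem simple_sub (F : 𝓑 ⥤ ModuleCat.{w} R) (N : ∀ c, Submodule R (F.obj c))
    (hN : ∀ {c d : 𝓑} (f : c ⟶ d), ∀ x ∈ N c, (F.map f).hom x ∈ N d)
    (hne : ∃ b, Nontrivial (N b)) (h : ∀ (b : 𝓑), ∀ x ∈ N b, x ≠ 0 → ∀ c, N c ≤ orbit F {x} c) :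
    Simple (sub F N hN) := by
  refine simple_of_orbit_eq_top _ hne ?_
  intro b x hx c
  have h₁ : N c ≤ _ := h b x.1 x.2 (fun h₀ => hx (Subtype.ext h₀)) c
  rw [eq_top_iff]
  intro y _
  have h₂ := h₁ y.2
  have h₃ := orbit_map (subι F N hN) x c
  change _ = orbit F {x.1} c at h₃
  rw [← h₃] at h₂
  obtain ⟨y', hy', h₄⟩ := h₂
  have h₅ : y' = y := Subtype.ext h₄
  exact h₅ ▸ hy'

/-! ## Subquotients of correspondence functors -/

section Subquotient

variable {F T : Corresp ⥤ ModuleCat.{max u 1} R}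

/-- The values of a subfunctor. -/
noncomputable def val (N : Subobject F) (X : Corresp) : Submodule R (F.obj X) :=
  LinearMap.range (N.arrow.app X).hom

theorem val_mono {M N : Subobject F} (h : M ≤ N) (X : Corresp) : val M X ≤ val N X := by
  rintro _ ⟨m, rfl⟩
  refine ⟨((Subobject.ofLE M N h).app X).hom m, ?_⟩
  have h₁ := congrArg (fun t => (t.app X).hom m) (Subobject.ofLE_arrow h)
  exact h₁

theorem val_mk (N : ∀ c, Submodule R (F.obj c))
    (hN : ∀ {c d : Corresp} (f : c ⟶ d), ∀ x ∈ N c, (F.map f).hom x ∈ N d) (X : Corresp) :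
    val (Subobject.mk (subι F N hN)) X = N X := by
  apply le_antisymm
  · rintro _ ⟨m, rfl⟩
    have h₁ := congrArg (fun t => (t.app X).hom m)
      (Subobject.underlyingIso_hom_comp_eq_mk (subι F N hN))
    rw [← h₁]
    exact Subtype.property _
  · intro x hx
    refine ⟨((Subobject.underlyingIso (subι F N hN)).inv.app X).hom ⟨x, hx⟩, ?_⟩
    have h₁ := congrArg (fun t => (t.app X).hom ⟨x, hx⟩)
      (Subobject.underlyingIso_arrow (subι F N hN))
    exact h₁

theorem map_mem_val (N : Subobject F) {X Y : Corresp} (f : X ⟶ Y) {x : F.obj X}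
    (hx : x ∈ val N X) : (F.map f).hom x ∈ val N Y := by
  obtain ⟨n, rfl⟩ := hx
  exact ⟨_, ConcreteCategory.congr_hom (N.arrow.naturality f) n⟩

theorem val_arrow_injective (N : Subobject F) (X : Corresp) :
    Function.Injective (N.arrow.app X).hom :=
  (ModuleCat.mono_iff_injective _).1 inferInstance

/-- Evaluation at a set is exact, so the abstract cokernel is an objectwise quotient. This gives
access to the elements of a subquotient. -/
theorem exists_projection {M N : Subobject F} {h : M ≤ N} (hT : IsSubquotient h T) :
    ∃ π : (N : Corresp ⥤ ModuleCat.{max u 1} R) ⟶ T, ∀ X,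
      Function.Surjective (π.app X).hom ∧
      ∀ n, (π.app X).hom n = 0 ↔ (N.arrow.app X).hom n ∈ val M X := by
  obtain ⟨i⟩ := hT
  have hzero : Subobject.ofLE M N h ≫ (cokernel.π (Subobject.ofLE M N h) ≫ i.hom) = 0 := by
    rw [← Category.assoc, cokernel.condition, zero_comp]
  refine ⟨cokernel.π _ ≫ i.hom, fun X => ⟨?_, fun n => ⟨fun hn => ?_, ?_⟩⟩⟩
  · have : Epi ((cokernel.π (Subobject.ofLE M N h) ≫ i.hom).app X) := inferInstance
    exact (ModuleCat.epi_iff_surjective _).1 this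
  · have hex : (ShortComplex.mk (Subobject.ofLE M N h) _ (cokernel.condition _)).Exact :=
      ShortComplex.exact_cokernel _
    have hex' := hex.map ((evaluation Corresp (ModuleCat.{max u 1} R)).obj X)
    rw [ShortComplex.moduleCat_exact_iff] at hex'
    have hn' : ((cokernel.π (Subobject.ofLE M N h)).app X).hom n = 0 := by
      have hinj : Function.Injective (i.hom.app X).hom :=
        (ModuleCat.mono_iff_injective _).1 inferInstance
      apply hinj
      rw [map_zero]
      exact hn
    obtain ⟨m, hm⟩ := hex' n hn'
    refine ⟨m, ?_⟩
    have h₁ := congrArg (fun t => (t.app X).hom m) (Subobject.ofLE_arrow h)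
    refine h₁.symm.trans ?_
    exact congrArg _ hm
  · rintro ⟨m, hm⟩
    have h₁ := congrArg (fun t => (t.app X).hom m) (Subobject.ofLE_arrow h)
    have h₂ : ((Subobject.ofLE M N h).app X).hom m = n :=
      val_arrow_injective N X (h₁.trans hm)
    rw [← h₂]
    exact congrArg (fun t => (t.app X).hom m) hzero

/-- A subquotient that does not vanish where the functor has a simple value has the same value. -/
theorem _root_.IsSubquotient.eval {X : Corresp} (hF : ∀ x : F.obj X, x ≠ 0 → orbit F {x} X = ⊤)
    [Nontrivial (T.obj X)] {M N : Subobject F} {h : M ≤ N} (hT : IsSubquotient h T) :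
    val N X = ⊤ ∧ val M X = ⊥ ∧ SameEvaluation F T X := by
  obtain ⟨π, hπ⟩ := exists_projection hT
  -- A subfunctor of `F` is zero or everything at `X`.
  have key : ∀ (P : Subobject F) (x : F.obj X), x ∈ val P X → x ≠ 0 → val P X = ⊤ := by
    intro P x hx hx0
    rw [eq_top_iff, ← hF x hx0]
    refine orbit_le ?_
    rintro f _ rfl
    exact map_mem_val P f hx
  obtain ⟨t, ht⟩ := exists_ne (0 : T.obj X)
  obtain ⟨n, rfl⟩ := (hπ X).1 t
  -- This one element shows that `N` is nonzero at `X` and that `M` is not everything at `X`, which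
  -- by `key` settles both values.
  have hn : (N.arrow.app X).hom n ∉ val M X := fun h' => ht (((hπ X).2 n).2 h')
  have hN : val N X = ⊤ := key N _ ⟨n, rfl⟩ (fun h0 => hn (h0 ▸ zero_mem _))
  have hM : val M X = ⊥ := by
    by_contra hne
    obtain ⟨x, hx, hx0⟩ := Submodule.exists_mem_ne_zero_of_ne_bot hne
    exact hn ((key M x hx hx0) ▸ Submodule.mem_top)
  refine ⟨hN, hM, ?_⟩
  have : IsIso (N.arrow.app X) := (ConcreteCategory.isIso_iff_bijective _).2
    ⟨val_arrow_injective N X, LinearMap.range_eq_top.1 hN⟩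
  have : IsIso (π.app X) := (ConcreteCategory.isIso_iff_bijective _).2 ⟨by
    change Function.Injective (π.app X).hom
    rw [← LinearMap.ker_eq_bot, LinearMap.ker_eq_bot']
    intro m hm
    rw [(hπ X).2 m, hM, Submodule.mem_bot] at hm
    apply val_arrow_injective N X
    rw [hm, map_zero], (hπ X).1⟩
  refine ⟨(asIso (N.arrow.app X)).symm ≪≫ asIso (π.app X), fun U => ?_⟩
  have h₁ := N.arrow.naturality U
  have h₂ := π.naturality U
  simp only [Iso.trans_hom, Iso.symm_hom, asIso_inv, asIso_hom, Category.assoc]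
  rw [← h₂, ← cancel_epi (N.arrow.app X), ← Category.assoc, ← h₁]
  simp

/-- A functor with a simple value at `X` has a simple subquotient with the same value at `X`. -/
theorem exists_simple_subquotient {X : Corresp} [Nontrivial (F.obj X)]
    (hF : ∀ x : F.obj X, x ≠ 0 → orbit F {x} X = ⊤) :
    ∃ (T : Corresp ⥤ ModuleCat.{max u 1} R) (M N : Subobject F) (h : M ≤ N),
      IsSubquotient h T ∧ Simple T ∧ Nontrivial (T.obj X) := by
  -- `N` is generated by `F(X)`, and `K` is the largest subfunctor of `F` vanishing at `X`. The
  -- simple subquotient is `N / (N ∩ K)`.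
  let N := orbit F (Set.univ : Set (F.obj X))
  let K : ∀ Y, Submodule R (F.obj Y) := fun Y => ⨅ g : Y ⟶ X, LinearMap.ker (F.map g).hom
  have memK : ∀ {Y} (v : F.obj Y), v ∈ K Y ↔ ∀ g : Y ⟶ X, (F.map g).hom v = 0 := by
    intro Y v
    simp [K]
  have hN : ∀ {c d : Corresp} (f : c ⟶ d), ∀ x ∈ N c, (F.map f).hom x ∈ N d :=
    map_orbit F Set.univ
  have hK : ∀ {c d : Corresp} (f : c ⟶ d), ∀ x ∈ N c ⊓ K c, (F.map f).hom x ∈ N d ⊓ K d := by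
    rintro c d f x ⟨hx, hx'⟩
    refine ⟨hN f x hx, (memK _).2 fun g => ?_⟩
    have := (memK x).1 hx' (f ≫ g)
    simpa using this
  let N' := Subobject.mk (subι F N hN)
  let M' := Subobject.mk (subι F (fun c => N c ⊓ K c) hK)
  have hN' : ∀ Y, val N' Y = N Y := val_mk N hN
  have hM' : ∀ Y, val M' Y = N Y ⊓ K Y := val_mk _ hK
  have hle : M' ≤ N' := by
    refine Subobject.mk_le_mk_of_comm
      { app := fun c => ModuleCat.ofHom (Submodule.inclusion inf_le_left)
        naturality := ?_ } ?_
    · intro c d f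
      ext x
      rfl
    · ext c x
      rfl
  refine ⟨cokernel (Subobject.ofLE M' N' hle), M', N', hle, ⟨Iso.refl _⟩, ?_⟩
  obtain ⟨π, hπ⟩ := exists_projection (h := hle) ⟨Iso.refl _⟩
  have hsub : ∀ {Y} (n : (N' : Corresp ⥤ ModuleCat.{max u 1} R).obj Y),
      (π.app Y).hom n ≠ 0 → ∃ g : Y ⟶ X, (F.map g).hom ((N'.arrow.app Y).hom n) ≠ 0 := by
    intro Y n hn
    by_contra! h₀
    apply hn
    rw [(hπ Y).2, hM']
    exact ⟨hN' Y ▸ ⟨n, rfl⟩, (memK _).2 h₀⟩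
  have hnt : Nontrivial ((cokernel (Subobject.ofLE M' N' hle)).obj X) := by
    obtain ⟨x, hx⟩ := exists_ne (0 : F.obj X)
    have hxN : x ∈ val N' X := by
      rw [hN']
      exact mem_orbit_self F (Set.mem_univ _)
    obtain ⟨n, rfl⟩ := hxN
    refine ⟨(π.app X).hom n, 0, fun h₀ => hx ?_⟩
    rw [(hπ X).2, hM'] at h₀
    have := (memK _).1 h₀.2 (𝟙 X)
    simpa using this
  refine ⟨simple_of_orbit_eq_top _ ⟨X, hnt⟩ ?_, hnt⟩
  intro Y t ht Z
  obtain ⟨n, rfl⟩ := (hπ Y).1 t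
  obtain ⟨g, hg⟩ := hsub n ht
  rw [← orbit_map π n Z]
  -- A representative outside `K` reaches a nonzero element of `F(X)`, which generates `F(X)`, which
  -- generates `N`. The argument is carried out in `F` and pulled back along the injective
  -- inclusion.
  have h₁ : orbit (N' : Corresp ⥤ ModuleCat.{max u 1} R) {n} Z = ⊤ := by
    apply Submodule.map_injective_of_injective (val_arrow_injective N' Z)
    rw [orbit_map, Submodule.map_top]
    refine le_antisymm ?_ ?_
    · rw [← orbit_map]
      exact LinearMap.map_le_range
    · change val N' Z ≤ _
      rw [hN']
      refine orbit_le fun f x _ => ?_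
      apply map_orbit F _ f
      have h₂ : orbit F {(F.map g).hom ((N'.arrow.app Y).hom n)} X ≤
          orbit F {(N'.arrow.app Y).hom n} X := orbit_le (by
        rintro f _ rfl
        exact map_orbit F _ f _ (map_mem_orbit F g rfl))
      rw [hF _ hg] at h₂
      exact h₂ Submodule.mem_top
  rw [h₁, Submodule.map_top, LinearMap.range_eq_top]
  exact (hπ Z).1

end Subquotient

/-! ## Composition factors at a smallest set -/

section Factor

variable {F G H T : Corresp ⥤ ModuleCat.{max u 1} R} {X : Corresp}

theorem _root_.SameEvaluation.symm (h : SameEvaluation F G X) : SameEvaluation G F X := by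
  obtain ⟨e, he⟩ := h
  refine ⟨e.symm, fun U => ?_⟩
  rw [Iso.symm_hom, Iso.comp_inv_eq, Category.assoc, he, Iso.inv_hom_id_assoc]

theorem _root_.SameEvaluation.trans (h : SameEvaluation F G X) (h' : SameEvaluation G H X) :
    SameEvaluation F H X := by
  obtain ⟨e, he⟩ := h
  obtain ⟨e', he'⟩ := h'
  refine ⟨e ≪≫ e', fun U => ?_⟩
  rw [Iso.trans_hom, ← Category.assoc, he, Category.assoc, he', Category.assoc]

theorem _root_.SameEvaluation.of_iso (i : F ≅ G) (X : Corresp) : SameEvaluation F G X :=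
  ⟨i.app X, fun U => i.hom.naturality U⟩

theorem _root_.SameEvaluation.nontrivial (h : SameEvaluation F G X) [Nontrivial (F.obj X)] :
    Nontrivial (G.obj X) :=
  h.choose.toLinearEquiv.toEquiv.symm.nontrivial

theorem _root_.SameEvaluation.nonempty_iso (h : SameEvaluation F G X) [Simple F] [Simple G]
    [Nontrivial (F.obj X)] : Nonempty (F ≅ G) := by
  have := SameEvaluation.nontrivial h
  obtain ⟨e, he⟩ := h
  exact nonempty_iso_of_simple (b := X) e.hom.hom e.toLinearEquiv.bijective
    (fun f x => ConcreteCategory.congr_hom (he f) x)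

theorem _root_.IsMinimalSet.exists_of_nontrivial (h : ∃ X, Nontrivial (F.obj X)) :
    ∃ X, IsMinimalSet F X := by
  classical
  have h' : ∃ n, ∃ X : Corresp, Nat.card X.carrier = n ∧ Nontrivial (F.obj X) := by
    obtain ⟨X, hX⟩ := h
    exact ⟨_, X, rfl, hX⟩
  obtain ⟨X, hX, hX'⟩ := Nat.find_spec h'
  refine ⟨X, hX', fun Z hZ => ?_⟩
  rw [hX] at hZ
  have := Nat.find_min h' hZ
  rw [← not_nontrivial_iff_subsingleton]
  exact fun hn => this ⟨Z, rfl, hn⟩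

theorem _root_.IsMinimalSet.card_eq {Y : Corresp} (h : IsMinimalSet F X) (h' : IsMinimalSet F Y) :
    Nat.card X.carrier = Nat.card Y.carrier := by
  rcases lt_trichotomy (Nat.card X.carrier) (Nat.card Y.carrier) with hlt | heq | hlt
  · exact absurd h.1 (not_nontrivial_iff_subsingleton.2 (h'.2 X hlt))
  · exact heq
  · exact absurd h'.1 (not_nontrivial_iff_subsingleton.2 (h.2 Y hlt))

theorem _root_.IsMinimalSet.of_card_eq {Y : Corresp} (h : IsMinimalSet F X)
    (hc : Nat.card X.carrier = Nat.card Y.carrier) : IsMinimalSet F Y := by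
  refine ⟨?_, fun Z hZ => h.2 Z (hc ▸ hZ)⟩
  obtain ⟨e⟩ : Nonempty (X.carrier ≃ Y.carrier) :=
    Finite.card_eq.1 hc
  -- The graph of the bijection and its transpose. Only the composite on `X` is needed, since it
  -- makes `F.map a` injective.
  let a : X ⟶ Y := ⟨{p | p.1 = e p.2}⟩
  let b : Y ⟶ X := ⟨{p | p.2 = e p.1}⟩
  have hab : a ≫ b = 𝟙 X := by
    apply Corresp.Hom.ext
    ext ⟨x, x'⟩
    change (∃ y, y = e x ∧ y = e x') ↔ x = x'
    simp
  obtain ⟨x, hx⟩ := (nontrivial_iff_exists_ne 0).1 h.1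
  refine ⟨(F.map a).hom x, 0, fun h₀ => hx ?_⟩
  have h₁ : (F.map (a ≫ b)).hom x = (F.map b).hom ((F.map a).hom x) := by simp
  rw [h₀, hab, map_zero] at h₁
  simpa using h₁

theorem _root_.IsMinimalSet.of_subsingleton (hF : IsMinimalSet F X) (hT : Nontrivial (T.obj X))
    (h : ∀ Z, Subsingleton (F.obj Z) → Subsingleton (T.obj Z)) : IsMinimalSet T X :=
  ⟨hT, fun Z hZ => h Z (hF.2 Z hZ)⟩

theorem _root_.IsMinimalSet.of_iso (h : IsMinimalSet F X) (i : F ≅ G) : IsMinimalSet G X :=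
  h.of_subsingleton
    (have := h.1; (SameEvaluation.of_iso i X).nontrivial)
    (fun Z _ => (i.app Z).toLinearEquiv.toEquiv.symm.subsingleton)

theorem _root_.IsSubquotient.subsingleton {M N : Subobject F} {h : M ≤ N} (hT : IsSubquotient h T)
    (Z : Corresp) (hZ : Subsingleton (F.obj Z)) : Subsingleton (T.obj Z) := by
  obtain ⟨π, hπ⟩ := exists_projection hT
  have := (val_arrow_injective N Z).subsingleton
  exact (hπ Z).1.subsingleton

/-- A factor at `X` takes the whole value `F(X)`. Conversely, the simple subquotient built from
`F(X)` has the same nonzero value at `X` as `T`, so the two simple functors are isomorphic. Being a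
factor at `X` is thereby reduced to a comparison of modules. -/
theorem isFactorAt_iff (hmin : IsMinimalSet F X)
    (hF : ∀ x : F.obj X, x ≠ 0 → orbit F {x} X = ⊤) :
    IsFactorAt F T X ↔ Simple T ∧ SameEvaluation F T X := by
  constructor
  · rintro ⟨⟨hs, M, N, h, hT⟩, hm⟩
    have := hm.1
    exact ⟨hs, (IsSubquotient.eval hF hT).2.2⟩
  · rintro ⟨hs, he⟩
    have := hmin.1
    obtain ⟨T₀, M, N, h, hT₀, hs₀, hn₀⟩ := exists_simple_subquotient hF
    have he₀ := (IsSubquotient.eval hF hT₀).2.2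
    obtain ⟨i⟩ := (he₀.symm.trans he).nonempty_iso
    refine ⟨⟨hs, M, N, h, ?_⟩, ?_⟩
    · obtain ⟨j⟩ := hT₀
      exact ⟨j ≪≫ i⟩
    · exact (hmin.of_subsingleton hn₀ (IsSubquotient.subsingleton hT₀)).of_iso i

theorem exists_isUniqueFactorAt (hmin : IsMinimalSet F X)
    (hF : ∀ x : F.obj X, x ≠ 0 → orbit F {x} X = ⊤) :
    ∃ T, IsUniqueFactorAt F T X ∧ SameEvaluation F T X := by
  have := hmin.1
  obtain ⟨T, M, N, h, hT, hs, hn⟩ := exists_simple_subquotient hF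
  have he := (IsSubquotient.eval hF hT).2.2
  refine ⟨T, ⟨(isFactorAt_iff hmin hF).2 ⟨hs, he⟩, ?_, ?_⟩, he⟩
  · intro T' hT'
    obtain ⟨hs', he'⟩ := (isFactorAt_iff hmin hF).1 hT'
    have := he'.nontrivial
    exact (he'.symm.trans he).nonempty_iso
  -- At `X` the subfunctor `N₁` is everything and `M₂` is zero, so `N₁ ≤ M₂` would force `F(X) = 0`.
  · rintro M₁ N₁ M₂ N₂ h₁ h₁₂ h₂ ⟨hT₁, hT₂⟩
    have hN₁ := (IsSubquotient.eval hF hT₁).1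
    have hM₂ := (IsSubquotient.eval hF hT₂).2.1
    have hle := val_mono h₁₂ X
    rw [hN₁, hM₂, top_le_iff] at hle
    exact top_ne_bot hle.symm

end Factor

end ModuleFunctor

namespace ModuleFunctor

open Limits

/-! ## Linear categories receiving the correspondences -/

section Reduction

variable {R : Type u} [CommRing R] {𝓑 : Type u₁} [Category.{v₁} 𝓑] [Preadditive 𝓑] [Linear R 𝓑]
  (J : Corresp ⥤ 𝓑)

variable (R) in
/-- The endomorphisms of `J X` spanned by those factoring through some `J Z` with `|Z| < |X|`. -/
def smallEnd (X : Corresp) : Submodule R (J.obj X ⟶ J.obj X) :=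
  Submodule.span R {f | ∃ (Z : Corresp) (_ : Nat.card Z.carrier < Nat.card X.carrier)
    (h : J.obj X ⟶ J.obj Z) (g : J.obj Z ⟶ J.obj X), f = h ≫ g}

variable (R) in
/-- The linear combinations of the endocorrespondences of `X` that factor through a smaller set. -/
noncomputable def smallCorresp (X : Corresp) : Submodule R ((X ⟶ X) →₀ R) :=
  Submodule.span R {a | ∃ (Z : Corresp) (_ : Nat.card Z.carrier < Nat.card X.carrier)
    (h : X ⟶ Z) (g : Z ⟶ X), a = Finsupp.single (h ≫ g) 1}

variable (R) in
/-- The linear extension of `J` on endomorphisms. -/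
noncomputable def linearExtension (X : Corresp) : ((X ⟶ X) →₀ R) →ₗ[R] (J.obj X ⟶ J.obj X) :=
  Finsupp.linearCombination R (fun U => J.map U)

variable (R) in
/-- Modulo morphisms factoring through smaller sets, the endomorphism algebra of `J X` is the algebra
of correspondences on `X`. -/
def ReducesToCorresp : Prop :=
  ∀ X : Corresp, ∃ θ : (J.obj X ⟶ J.obj X) →ₗ[R] ((X ⟶ X) →₀ R),
    (∀ U, θ (J.map U) = Finsupp.single U 1) ∧
    (∀ f, f - linearExtension R J X (θ f) ∈ smallEnd R J X) ∧
    ∀ f ∈ smallEnd R J X, θ f ∈ smallCorresp R X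

variable {J}

/-- Together with `comp_mem_smallEnd'` this makes `smallEnd` a two-sided ideal, so one may compute
modulo it inside products. -/
theorem comp_mem_smallEnd {X : Corresp} {f : J.obj X ⟶ J.obj X} (hf : f ∈ smallEnd R J X)
    (g : J.obj X ⟶ J.obj X) : f ≫ g ∈ smallEnd R J X := by
  induction hf using Submodule.span_induction with
  | mem f hf =>
    obtain ⟨Z, hZ, h, k, rfl⟩ := hf
    exact Submodule.subset_span ⟨Z, hZ, h, k ≫ g, Category.assoc _ _ _⟩
  | zero => simp
  | add a b _ _ ha hb => rw [Preadditive.add_comp]; exact add_mem ha hb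
  | smul r a _ ha => rw [Linear.smul_comp]; exact Submodule.smul_mem _ r ha

theorem comp_mem_smallEnd' {X : Corresp} {f : J.obj X ⟶ J.obj X} (hf : f ∈ smallEnd R J X)
    (g : J.obj X ⟶ J.obj X) : g ≫ f ∈ smallEnd R J X := by
  induction hf using Submodule.span_induction with
  | mem f hf =>
    obtain ⟨Z, hZ, h, k, rfl⟩ := hf
    exact Submodule.subset_span ⟨Z, hZ, g ≫ h, k, (Category.assoc _ _ _).symm⟩
  | zero => simp
  | add a b _ _ ha hb => rw [Preadditive.comp_add]; exact add_mem ha hb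
  | smul r a _ ha => rw [Linear.comp_smul]; exact Submodule.smul_mem _ r ha

/-- The value of a correspondence functor at a smallest set is a module for the endomorphisms
of `J X`. -/
theorem ReducesToCorresp.exists_rep (hJ : ReducesToCorresp R J)
    {T : Corresp ⥤ ModuleCat.{max u 1} R} {X : Corresp} (hT : IsMinimalSet T X) :
    ∃ ρ : (J.obj X ⟶ J.obj X) →ₗ[R] Module.End R (T.obj X),
      (∀ U, ρ (J.map U) = (T.map U).hom) ∧ (∀ f g, ρ (f ≫ g) = ρ g ∘ₗ ρ f) ∧
      ∀ f ∈ smallEnd R J X, ρ f = 0 := by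
  obtain ⟨θ, h₁, h₂, h₃⟩ := hJ X
  -- `L` is the action of combinations of correspondences on `T(X)`. It kills `smallCorresp` because
  -- `T` vanishes on smaller sets, so `L ∘ₗ θ` depends only on the class modulo `smallEnd`.
  let L : ((X ⟶ X) →₀ R) →ₗ[R] Module.End R (T.obj X) :=
    Finsupp.linearCombination R (fun U => (T.map U).hom)
  have hL : smallCorresp R X ≤ LinearMap.ker L := by
    refine Submodule.span_le.2 ?_
    rintro _ ⟨Z, hZ, h, g, rfl⟩
    have := hT.2 Z hZ
    change L _ = 0
    ext x
    simp only [L, Finsupp.linearCombination_single, one_smul, Functor.map_comp]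
    change (T.map g).hom ((T.map h).hom x) = 0
    rw [Subsingleton.elim ((T.map h).hom x) 0, map_zero]
  have hU : ∀ U, L (θ (J.map U)) = (T.map U).hom := by
    intro U
    rw [h₁]
    simp [L]
  have hsmall : ∀ f ∈ smallEnd R J X, L (θ f) = 0 := fun f hf => hL (h₃ f hf)
  have hcongr : ∀ f g, f - g ∈ smallEnd R J X → L (θ f) = L (θ g) := by
    intro f g h
    rw [← sub_eq_zero, ← map_sub, ← map_sub]
    exact hsmall _ h
  refine ⟨L ∘ₗ θ, hU, fun f g => ?_, hsmall⟩
  change L (θ (f ≫ g)) = L (θ g) ∘ₗ L (θ f)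
  -- Multiplicativity of `θ` is not assumed. It is enough that `L ∘ₗ θ` respects products of the
  -- morphisms `J.map U`, since every endomorphism is a combination of these modulo the ideal.
  have hmul : ∀ a b : (X ⟶ X) →₀ R, L (θ (linearExtension R J X a ≫ linearExtension R J X b)) =
      L (θ (linearExtension R J X b)) ∘ₗ L (θ (linearExtension R J X a)) := by
    intro a b
    induction a using Finsupp.induction_linear with
    | zero => simp
    | add a a' ha ha' => simp only [map_add, Preadditive.add_comp, ha, ha', LinearMap.comp_add]
    | single U r =>
      induction b using Finsupp.induction_linear with
      | zero => simp
      | add a a' ha ha' => simp only [map_add, Preadditive.comp_add, ha, ha', LinearMap.add_comp]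
      | single V s =>
        simp only [linearExtension, Finsupp.linearCombination_single, Linear.smul_comp,
          Linear.comp_smul, map_smul, ← J.map_comp, hU, LinearMap.smul_comp, LinearMap.comp_smul]
        rw [T.map_comp, smul_comm]
        rfl
  rw [hcongr f _ (h₂ f), hcongr g _ (h₂ g), ← hmul]
  refine (hcongr _ (linearExtension R J X (θ f) ≫ g) ?_).trans (hcongr _ _ ?_)
  · rw [← Preadditive.sub_comp]
    exact comp_mem_smallEnd (h₂ f) g
  · rw [← Preadditive.comp_sub]
    exact comp_mem_smallEnd' (h₂ g) _

/-! ### Values of linear functors at a smallest set -/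

section Linear

variable (S : 𝓑 ⥤ ModuleCat.{w} R) [S.Additive] [S.Linear R]

/-- The action of morphisms on an element, as a linear map. -/
def actOn {b : 𝓑} (x : S.obj b) (c : 𝓑) : (b ⟶ c) →ₗ[R] S.obj c where
  toFun f := (S.map f).hom x
  map_add' f g := by simp [S.map_add]
  map_smul' r f := by simp [S.map_smul]

variable {S}

theorem actOn_smallEnd {X : Corresp} (hX : IsMinimalSet (J ⋙ S) X) (x : S.obj (J.obj X))
    {f : J.obj X ⟶ J.obj X} (hf : f ∈ smallEnd R J X) : (S.map f).hom x = 0 := by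
  have h : smallEnd R J X ≤ LinearMap.ker (actOn S x (J.obj X)) := by
    refine Submodule.span_le.2 ?_
    rintro _ ⟨Z, hZ, h, g, rfl⟩
    have : Subsingleton (S.obj (J.obj Z)) := hX.2 Z hZ
    change (S.map (h ≫ g)).hom x = 0
    rw [S.map_comp]
    change (S.map g).hom ((S.map h).hom x) = 0
    rw [Subsingleton.elim ((S.map h).hom x) 0, map_zero]
  exact h hf

/-- By simplicity of `S`, the endomorphisms of `J X` generate `S(J X)` from `x`. Each of them acts
like a combination of correspondences, because `smallEnd` acts as zero; so `S(J X)` is simple for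
correspondences alone. -/
theorem ReducesToCorresp.orbit_comp_eq_top (hJ : ReducesToCorresp R J) [Simple S] {X : Corresp}
    (hX : IsMinimalSet (J ⋙ S) X) (x : (J ⋙ S).obj X) (hx : x ≠ 0) :
    orbit (J ⋙ S) {x} X = ⊤ := by
  obtain ⟨θ, h₁, h₂, h₃⟩ := hJ X
  rw [eq_top_iff]
  change (⊤ : Submodule R (S.obj (J.obj X))) ≤ _
  rw [← orbit_eq_top S (b := J.obj X) hx (J.obj X)]
  refine orbit_singleton_le fun f => ?_
  have h₄ : actOn S x (J.obj X) f = actOn S x (J.obj X) (linearExtension R J X (θ f)) := by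
    rw [← sub_eq_zero, ← map_sub]
    exact actOn_smallEnd hX _ (h₂ f)
  change actOn S x (J.obj X) f ∈ _
  rw [h₄, linearExtension, Finsupp.linearCombination_apply, Finsupp.sum, map_sum]
  refine Submodule.sum_mem _ fun U _ => ?_
  rw [map_smul]
  exact Submodule.smul_mem _ _ (map_mem_orbit (J ⋙ S) U rfl)

/-- Modulo `smallEnd`, which acts as zero on both values, compatibility with correspondences is
compatibility with all endomorphisms of `J X`. Hence `nonempty_iso_of_simple` applies. This carries
the injectivity of `S ↦ T`. -/
theorem ReducesToCorresp.nonempty_iso (hJ : ReducesToCorresp R J) [Simple S]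
    {S' : 𝓑 ⥤ ModuleCat.{w} R} [S'.Additive] [S'.Linear R] [Simple S'] {X : Corresp}
    (hX : IsMinimalSet (J ⋙ S) X) (hX' : IsMinimalSet (J ⋙ S') X)
    (e : S.obj (J.obj X) ≃ₗ[R] S'.obj (J.obj X))
    (he : ∀ (U : X ⟶ X) x, e ((S.map (J.map U)).hom x) = (S'.map (J.map U)).hom (e x)) :
    Nonempty (S ≅ S') := by
  have : Nontrivial (S.obj (J.obj X)) := hX.1
  have : Nontrivial (S'.obj (J.obj X)) := hX'.1
  refine nonempty_iso_of_simple (b := J.obj X) e.toLinearMap e.bijective fun f x => ?_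
  obtain ⟨θ, h₁, h₂, h₃⟩ := hJ X
  have h₄ : actOn S x (J.obj X) f = actOn S x (J.obj X) (linearExtension R J X (θ f)) := by
    rw [← sub_eq_zero, ← map_sub]
    exact actOn_smallEnd hX _ (h₂ f)
  have h₅ : actOn S' (e x) (J.obj X) f =
      actOn S' (e x) (J.obj X) (linearExtension R J X (θ f)) := by
    rw [← sub_eq_zero, ← map_sub]
    exact actOn_smallEnd hX' _ (h₂ f)
  change e (actOn S x (J.obj X) f) = actOn S' (e x) (J.obj X) f
  rw [h₄, h₅]
  simp only [linearExtension, Finsupp.linearCombination_apply, Finsupp.sum, map_sum, map_smul]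
  exact Finset.sum_congr rfl fun U _ => congrArg _ (he U x)

end Linear

end Reduction

/-! ## Simple functors with a prescribed value -/

section Coinduced

variable {R : Type u} [CommRing R] {𝓑 : Type u₁} [Category.{w} 𝓑] [Preadditive 𝓑] [Linear R 𝓑]
  {b : 𝓑} {V : Type w} [AddCommGroup V] [Module R V] (ρ : (b ⟶ b) →ₗ[R] Module.End R V)

/-- The equivariant linear maps from `Hom(c, b)` to an `End(b)`-module. -/
def equivariantMaps (c : 𝓑) : Submodule R ((c ⟶ b) →ₗ[R] V) where
  carrier := {φ | ∀ h a, φ (h ≫ a) = ρ a (φ h)}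
  add_mem' hφ hψ h a := by simp [hφ h a, hψ h a]
  zero_mem' h a := by simp
  smul_mem' r φ hφ h a := by simp [hφ h a]

/-- The functor coinduced from an `End(b)`-module. -/
def coinduced : 𝓑 ⥤ ModuleCat.{w} R where
  obj c := ModuleCat.of R (equivariantMaps ρ c)
  map {c d} f := ModuleCat.ofHom
    ((LinearMap.lcomp R V (Linear.leftComp R b f)).restrict (p := equivariantMaps ρ c)
      (q := equivariantMaps ρ d) (by
        intro φ hφ h a
        have := hφ (f ≫ h) a
        simpa using this))
  map_id c := by
    ext φ h
    exact congrArg φ.1 (Category.id_comp h)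
  map_comp f g := by
    ext φ h
    exact congrArg φ.1 (Category.assoc f g h)

theorem coinduced_map_apply {c d : 𝓑} (f : c ⟶ d) (φ : equivariantMaps ρ c) (h : d ⟶ b) :
    (((coinduced ρ).map f).hom φ : equivariantMaps ρ d).1 h = φ.1 (f ≫ h) := rfl

/-- The subfunctor of the coinduced functor generated by its value at `b`. -/
def coinducedSimple : 𝓑 ⥤ ModuleCat.{w} R :=
  sub (coinduced ρ) (orbit (coinduced ρ) (Set.univ : Set ((coinduced ρ).obj b)))
    (map_orbit (coinduced ρ) Set.univ)

instance : (coinducedSimple ρ).Additive where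
  map_add {c d f g} := by
    refine ModuleCat.hom_ext (LinearMap.ext fun φ =>
      Subtype.ext (Subtype.ext (LinearMap.ext fun h => ?_)))
    change φ.1.1 ((f + g) ≫ h) = φ.1.1 (f ≫ h) + φ.1.1 (g ≫ h)
    rw [Preadditive.add_comp, map_add]

instance : (coinducedSimple ρ).Linear R where
  map_smul {c d} f r := by
    refine ModuleCat.hom_ext (LinearMap.ext fun φ =>
      Subtype.ext (Subtype.ext (LinearMap.ext fun h => ?_)))
    change φ.1.1 ((r • f) ≫ h) = r • φ.1.1 (f ≫ h)
    rw [Linear.smul_comp, map_smul]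

variable (hid : ρ (𝟙 b) = LinearMap.id) (hmul : ∀ f g, ρ (f ≫ g) = ρ g ∘ₗ ρ f)

include hid hmul in
/-- The value at `b` of the coinduced functor. -/
theorem exists_evalEquiv : ∃ e : equivariantMaps ρ b ≃ₗ[R] V, ∀ φ, e φ = φ.1 (𝟙 b) := by
  refine ⟨LinearEquiv.ofBijective ((LinearMap.applyₗ (𝟙 b)).comp (equivariantMaps ρ b).subtype)
    ⟨?_, ?_⟩, fun φ => rfl⟩
  · intro φ ψ h
    ext f
    have h₁ := φ.2 (𝟙 b) f
    have h₂ := ψ.2 (𝟙 b) f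
    rw [Category.id_comp] at h₁ h₂
    rw [h₁, h₂]
    exact congrArg (ρ f) h
  · intro v
    refine ⟨⟨LinearMap.applyₗ v ∘ₗ ρ, fun f g => ?_⟩, ?_⟩
    · change ρ (f ≫ g) v = ρ g (ρ f v)
      rw [hmul]
      rfl
    · change ρ (𝟙 b) v = v
      rw [hid]
      rfl

-- A nonzero equivariant map on `Hom(c, b)` is nonzero at some `h`, so transport along `h` gives a
-- nonzero element at `b`. The value at `b` is the simple module `V`, so this element generates it,
-- and with it the whole subfunctor.
include hid hmul in
theorem simple_coinducedSimple [Nontrivial V]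
    (hV : ∀ v : V, v ≠ 0 → Submodule.span R (Set.range fun f => ρ f v) = ⊤) :
    Simple (coinducedSimple ρ) := by
  obtain ⟨e, he⟩ := exists_evalEquiv ρ hid hmul
  have heq : ∀ (f : b ⟶ b) (φ : equivariantMaps ρ b),
      e (((coinduced ρ).map f).hom φ) = ρ f (e φ) := by
    intro f φ
    refine (he _).trans ?_
    rw [he φ, coinduced_map_apply, Category.comp_id, ← φ.2, Category.id_comp]
  have htop : ∀ φ : (coinduced ρ).obj b, φ ≠ 0 → orbit (coinduced ρ) {φ} b = ⊤ := by
    intro φ hφ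
    have hφ' : e φ ≠ 0 := fun h => hφ (e.map_eq_zero_iff.1 h)
    rw [eq_top_iff]
    intro ψ _
    have h₁ : Submodule.span R (Set.range fun f => ρ f (e φ)) ≤
        (orbit (coinduced ρ) {φ} b).map e.toLinearMap := by
      refine Submodule.span_le.2 ?_
      rintro _ ⟨f, rfl⟩
      exact ⟨_, map_mem_orbit (coinduced ρ) f rfl, heq f φ⟩
    rw [hV _ hφ'] at h₁
    obtain ⟨ψ', h₂, h₃⟩ := h₁ (Submodule.mem_top (x := e ψ))
    rw [← e.injective h₃]
    exact h₂
  refine simple_sub _ _ (map_orbit (coinduced ρ) Set.univ) ⟨b, ?_⟩ ?_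
  · have : Nontrivial (equivariantMaps ρ b) := e.toEquiv.nontrivial
    obtain ⟨φ, hφ⟩ := exists_ne (0 : equivariantMaps ρ b)
    exact ⟨⟨φ, mem_orbit_self _ (Set.mem_univ _)⟩, 0, fun h => hφ (congrArg Subtype.val h)⟩
  · intro c φ _ hφ d
    obtain ⟨h, hh⟩ : ∃ h : c ⟶ b, (φ : equivariantMaps ρ c).1 h ≠ 0 := by
      by_contra! h₀
      apply hφ
      exact Subtype.ext (LinearMap.ext h₀)
    have hψ : ((coinduced ρ).map h).hom φ ≠ 0 := by
      intro h₀
      apply hh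
      have h₁ := congrArg (fun ψ : equivariantMaps ρ b => ψ.1 (𝟙 b)) h₀
      change (φ : equivariantMaps ρ c).1 (h ≫ 𝟙 b) = 0 at h₁
      rwa [Category.comp_id] at h₁
    have h₁ : ∀ ψ, ψ ∈ orbit (coinduced ρ) {φ} b := by
      have h₂ : orbit (coinduced ρ) {((coinduced ρ).map h).hom φ} b ≤
          orbit (coinduced ρ) {φ} b := orbit_le (by
        rintro f _ rfl
        exact map_orbit _ _ f _ (map_mem_orbit _ h rfl))
      rw [htop _ hψ] at h₂
      exact fun ψ => h₂ Submodule.mem_top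
    exact orbit_le fun f ψ _ => map_orbit _ _ f ψ (h₁ ψ)

include hid hmul in
theorem exists_coinducedSimpleEquiv : ∃ e : (coinducedSimple ρ).obj b ≃ₗ[R] V,
    ∀ (f : b ⟶ b) φ, e (((coinducedSimple ρ).map f).hom φ) = ρ f (e φ) := by
  obtain ⟨e, he⟩ := exists_evalEquiv ρ hid hmul
  have htop : orbit (coinduced ρ) (Set.univ : Set ((coinduced ρ).obj b)) b = ⊤ := by
    rw [eq_top_iff]
    exact fun φ _ => mem_orbit_self _ (Set.mem_univ _)
  refine ⟨LinearEquiv.ofTop _ htop ≪≫ₗ e, fun f φ => ?_⟩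
  refine (he _).trans (Eq.trans ?_ (congrArg (ρ f) (he φ.1)).symm)
  refine Eq.trans ?_ (φ.1.2 (𝟙 b) f)
  change φ.1.1 (f ≫ 𝟙 b) = _
  rw [Category.comp_id, Category.id_comp]

/-- The generators at `c` are transports of some `φ` along `f : b ⟶ c`. They send `g` to `φ (f ≫ g)
= ρ (f ≫ g) (φ (𝟙 b))`, which involves only loops through `c`. -/
theorem subsingleton_coinducedSimple {c : 𝓑}
    (h : ∀ (f : b ⟶ c) (g : c ⟶ b), ρ (f ≫ g) = 0) :
    Subsingleton ((coinducedSimple ρ).obj c) := by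
  have hbot : orbit (coinduced ρ) (Set.univ : Set ((coinduced ρ).obj b)) c ≤ ⊥ := by
    refine orbit_le fun f φ _ => ?_
    rw [Submodule.mem_bot]
    refine Subtype.ext (LinearMap.ext fun g => ?_)
    change (φ : equivariantMaps ρ b).1 (f ≫ g) = 0
    have h₁ := (φ : equivariantMaps ρ b).2 (𝟙 b) (f ≫ g)
    rw [h, Category.id_comp] at h₁
    exact h₁
  refine ⟨fun x y => ?_⟩
  have hx := hbot x.2
  have hy := hbot y.2
  rw [Submodule.mem_bot] at hx hy
  exact Subtype.ext (hx.trans hy.symm)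

end Coinduced

/-! ## The correspondence between simple functors -/

section Main

variable {R : Type u} [CommRing R]

/-- A compatible relation that is bijective up to equivalence induces a bijection of quotients. -/
theorem exists_quotient_equiv {α β : Type*} {r : Setoid α} {s : Setoid β} (P : α → β → Prop)
    (hcongr : ∀ a a' b b', a ≈ a' → b ≈ b' → P a b → P a' b')
    (h₁ : ∀ a, ∃ b, P a b) (h₂ : ∀ b, ∃ a, P a b)
    (h₃ : ∀ a b b', P a b → P a b' → b ≈ b') (h₄ : ∀ a a' b, P a b → P a' b → a ≈ a') :
    ∃ Φ : Quotient r ≃ Quotient s, ∀ a b, Φ ⟦a⟧ = ⟦b⟧ ↔ P a b := by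
  choose f hf using h₁
  let F : Quotient r → Quotient s := Quotient.lift (fun a => ⟦f a⟧) (fun a a' h =>
    Quotient.sound (h₃ a' _ _ (hcongr _ _ _ _ h (Setoid.refl _) (hf a)) (hf a')))
  have key : ∀ a b, F ⟦a⟧ = ⟦b⟧ ↔ P a b := by
    intro a b
    constructor
    · intro h
      exact hcongr _ _ _ _ (Setoid.refl _) (Quotient.exact h) (hf a)
    · intro h
      exact Quotient.sound (h₃ a _ _ (hf a) h)
  refine ⟨Equiv.ofBijective F ⟨?_, ?_⟩, key⟩
  · intro x y
    induction x using Quotient.inductionOn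
    induction y using Quotient.inductionOn with | h a' =>
    intro h
    exact Quotient.sound (h₄ _ _ _ ((key _ _).1 h) (hf a'))
  · intro y
    induction y using Quotient.inductionOn with | h b =>
    obtain ⟨a, ha⟩ := h₂ b
    exact ⟨⟦a⟧, (key a b).2 ha⟩

variable {𝓑 : Type u₁} [Category.{max u 1} 𝓑] [Preadditive 𝓑] [Linear R 𝓑] {J : Corresp ⥤ 𝓑}

/-- Surjectivity of `S ↦ T`. The module `T(X)`, with the action of `End(J X)` from `exists_rep`, is
simple because correspondences alone already generate it from any nonzero element. `coinducedSimple`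
realizes it, and vanishes at smaller sets because loops through them act as zero. -/
theorem ReducesToCorresp.exists_simpleNonvanishing (hJ : ReducesToCorresp R J)
    (T : Corresp ⥤ ModuleCat.{max u 1} R) [Simple T] :
    ∃ (S : 𝓑 ⥤ ModuleCat.{max u 1} R) (X : Corresp), simpleNonvanishing R J S ∧
      IsMinimalSet (J ⋙ S) X ∧ SameEvaluation (J ⋙ S) T X := by
  obtain ⟨X, hX⟩ := IsMinimalSet.exists_of_nontrivial (nontrivial_of_simple T)
  obtain ⟨ρ, hρ, hmul, hsmall⟩ := hJ.exists_rep hX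
  have := hX.1
  have hid : ρ (𝟙 (J.obj X)) = LinearMap.id := by
    rw [← J.map_id, hρ, T.map_id]
    rfl
  have hV : ∀ v : T.obj X, v ≠ 0 → Submodule.span R (Set.range fun f => ρ f v) = ⊤ := by
    intro v hv
    rw [eq_top_iff, ← orbit_eq_top T hv X]
    refine orbit_singleton_le fun U => ?_
    refine Submodule.subset_span ⟨J.map U, ?_⟩
    change ρ (J.map U) v = _
    rw [hρ]
  have hS := simple_coinducedSimple ρ hid hmul hV
  obtain ⟨e, he⟩ := exists_coinducedSimpleEquiv ρ hid hmul
  have hnt : Nontrivial ((coinducedSimple ρ).obj (J.obj X)) := e.toEquiv.nontrivial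
  refine ⟨coinducedSimple ρ, X, ⟨inferInstance, inferInstance, hS, X, hnt⟩,
    ⟨hnt, fun Z hZ => ?_⟩, e.toModuleIso, fun U => ?_⟩
  · exact subsingleton_coinducedSimple ρ fun f g =>
      hsmall _ (Submodule.subset_span ⟨Z, hZ, f, g, rfl⟩)
  · ext φ
    refine (he (J.map U) φ).trans ?_
    rw [hρ]
    rfl

theorem ReducesToCorresp.main (hJ : ReducesToCorresp R J) :
    (∀ S, simpleNonvanishing R J S →
        (∃ X, IsMinimalSet (J ⋙ S) X) ∧
        ∀ X, IsMinimalSet (J ⋙ S) X →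
          ∃ T, IsUniqueFactorAt (J ⋙ S) T X ∧ SameEvaluation (J ⋙ S) T X) ∧
      ∃ Φ : IsoClasses (simpleNonvanishing R J) ≃ IsoClasses (simpleCorresp R),
        ∀ (S : (simpleNonvanishing R J).FullSubcategory)
          (T : (simpleCorresp R).FullSubcategory) (X : Corresp),
          IsMinimalSet (J ⋙ S.obj) X →
            (Φ (isoClass S) = isoClass T ↔ IsFactorAt (J ⋙ S.obj) T.obj X) := by
  have hmin : ∀ S, simpleNonvanishing R J S → ∃ X, IsMinimalSet (J ⋙ S) X :=
    fun S hS => IsMinimalSet.exists_of_nontrivial hS.2.2.2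
  have hfactor : ∀ S, simpleNonvanishing R J S → ∀ X, IsMinimalSet (J ⋙ S) X → ∀ T,
      (IsFactorAt (J ⋙ S) T X ↔ Simple T ∧ SameEvaluation (J ⋙ S) T X) := by
    rintro S ⟨_, _, _, _⟩ X hX T
    exact isFactorAt_iff hX (hJ.orbit_comp_eq_top hX)
  have hexists : ∀ S, simpleNonvanishing R J S → ∀ X, IsMinimalSet (J ⋙ S) X →
      ∃ T, IsUniqueFactorAt (J ⋙ S) T X ∧ SameEvaluation (J ⋙ S) T X := by
    rintro S ⟨_, _, _, _⟩ X hX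
    exact exists_isUniqueFactorAt hX (hJ.orbit_comp_eq_top hX)
  have htransport : ∀ {S T : Corresp ⥤ ModuleCat.{max u 1} R} {X X' : Corresp},
      IsMinimalSet S X → IsMinimalSet S X' → IsFactorAt S T X → IsFactorAt S T X' :=
    fun hX hX' h => ⟨h.1, h.2.of_card_eq (hX.card_eq hX')⟩
  refine ⟨fun S hS => ⟨hmin S hS, hexists S hS⟩, ?_⟩
  obtain ⟨Φ, hΦ⟩ := exists_quotient_equiv
    (r := isIsomorphicSetoid (simpleNonvanishing R J).FullSubcategory)
    (s := isIsomorphicSetoid (simpleCorresp R).FullSubcategory)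
    (fun S T => ∃ X, IsMinimalSet (J ⋙ S.obj) X ∧ IsFactorAt (J ⋙ S.obj) T.obj X)
    (by
      rintro S S' T T' ⟨i⟩ ⟨j⟩ ⟨X, hX, h⟩
      have i' : J ⋙ S.obj ≅ J ⋙ S'.obj := Functor.isoWhiskerLeft J ((ObjectProperty.ι _).mapIso i)
      have j' : T.obj ≅ T'.obj := (ObjectProperty.ι _).mapIso j
      refine ⟨X, hX.of_iso i', (hfactor _ S'.2 X (hX.of_iso i') _).2 ⟨T'.2, ?_⟩⟩
      exact ((SameEvaluation.of_iso i' X).symm.trans ((hfactor _ S.2 X hX _).1 h).2).trans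
        (SameEvaluation.of_iso j' X))
    (by
      intro S
      obtain ⟨X, hX⟩ := hmin _ S.2
      obtain ⟨T, hT, -⟩ := hexists _ S.2 X hX
      exact ⟨⟨T, hT.1.1.1⟩, X, hX, hT.1⟩)
    (by
      intro T
      have : Simple T.obj := T.2
      obtain ⟨S, X, hS, hX, he⟩ := hJ.exists_simpleNonvanishing T.obj
      exact ⟨⟨S, hS⟩, X, hX, (hfactor S hS X hX _).2 ⟨T.2, he⟩⟩)
    (by
      rintro S T T' ⟨X, hX, h⟩ ⟨X', hX', h'⟩
      obtain ⟨T₀, hT₀, -⟩ := hexists _ S.2 X hX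
      obtain ⟨i⟩ := hT₀.2.1 _ h
      obtain ⟨j⟩ := hT₀.2.1 _ (htransport hX' hX h')
      exact ⟨ObjectProperty.isoMk _ (i ≪≫ j.symm)⟩)
    (by
      rintro S S' T ⟨X, hX, h⟩ ⟨X', hX', h'⟩
      -- Both `X` and `X'` are smallest sets for `T`, hence of equal size, so a single `X` serves
      -- `S` and `S'`. There both values are identified with `T(X)`.
      have hX'' : IsMinimalSet (J ⋙ S'.obj) X := hX'.of_card_eq (h'.2.card_eq h.2)
      have he := ((hfactor _ S.2 X hX _).1 h).2
      have he' := ((hfactor _ S'.2 X hX'' _).1 (htransport hX' hX'' h')).2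
      obtain ⟨e, he⟩ := he.trans he'.symm
      obtain ⟨S, _, _, _, _⟩ := S
      obtain ⟨S', _, _, _, _⟩ := S'
      obtain ⟨i⟩ := hJ.nonempty_iso hX hX'' e.toLinearEquiv
        (fun U x => ConcreteCategory.congr_hom (he U) x)
      exact ⟨ObjectProperty.isoMk _ i⟩)
  refine ⟨Φ, fun S T X hX => (hΦ S T).trans ⟨?_, fun h => ⟨X, hX, h⟩⟩⟩
  rintro ⟨X', hX', h⟩
  exact htransport hX' hX h

end Main

end ModuleFunctor

/-! ## Thin bisets between posets of subsets -/

namespace ThinBiset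

variable {X Y Z : Type}

/-- A relation between subsets defining a birepresentable biset with at most one element in each
value. -/
structure IsThin (W : Set Y → Set X → Prop) : Prop where
  left : ∀ A, (∃ B, W B A) → ∃ s, ∀ B, W B A ↔ s ≤ B
  right : ∀ B, (∃ A, W B A) → ∃ t, ∀ A, W B A ↔ A ≤ t

namespace IsThin

variable {W : Set Y → Set X → Prop} {W' : Set X → Set Z → Prop}

theorem mono_left (hW : IsThin W) {B B' : Set Y} {A : Set X} (h : W B A) (hB : B ≤ B') :
    W B' A := by
  obtain ⟨s, hs⟩ := hW.left A ⟨B, h⟩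
  exact (hs B').2 (((hs B).1 h).trans hB)

theorem anti_right (hW : IsThin W) {B : Set Y} {A A' : Set X} (h : W B A) (hA : A' ≤ A) :
    W B A' := by
  obtain ⟨t, ht⟩ := hW.right B ⟨A, h⟩
  exact (ht A').2 (hA.trans ((ht A).1 h))

/-- For fixed `A` the possible middle subsets form the up-set of some `s`, and `W` is decreasing in
its second argument, so the composite at `A` is just `W C s`. Rows are dual. -/
theorem comp (hW : IsThin W) (hW' : IsThin W') :
    IsThin (fun C A => ∃ B, W C B ∧ W' B A) where
  left A := by
    rintro ⟨C, B, h, h'⟩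
    obtain ⟨s, hs⟩ := hW'.left A ⟨B, h'⟩
    obtain ⟨r, hr⟩ := hW.left s ⟨C, hW.anti_right h ((hs B).1 h')⟩
    refine ⟨r, fun C' => ⟨?_, fun h₁ => ⟨s, (hr C').2 h₁, (hs s).2 le_rfl⟩⟩⟩
    rintro ⟨B', h₁, h₂⟩
    exact (hr C').1 (hW.anti_right h₁ ((hs B').1 h₂))
  right C := by
    rintro ⟨A, B, h, h'⟩
    obtain ⟨s, hs⟩ := hW.right C ⟨B, h⟩
    obtain ⟨r, hr⟩ := hW'.right s ⟨A, hW'.mono_left h' ((hs B).1 h)⟩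
    refine ⟨r, fun A' => ⟨?_, fun h₁ => ⟨s, (hs s).2 le_rfl, (hr A').2 h₁⟩⟩⟩
    rintro ⟨B', h₁, h₂⟩
    exact (hr A').1 (hW'.mono_left h₂ ((hs B').1 h₁))

end IsThin

/-- The biset of a thin relation. -/
def thin (W : Set Y → Set X → Prop) (hW : IsThin W) : BirepBiset (Set Y) (Set X) :=
  ⟨Biset.mk' (fun B A => PLift (W B A))
    (fun α β u => ⟨hW.anti_right (hW.mono_left u.down (leOfHom α)) (leOfHom β)⟩)
    (fun _ => rfl) (fun _ _ _ _ _ => rfl), by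
    constructor
    · rw [Biset.leftRepresentable_iff]
      intro A
      -- This index set has at most one element, and is empty exactly when `W` relates nothing to
      -- `A`.
      refine ⟨{s // ∀ B, W B A ↔ s ≤ B}, Subtype.val, fun i => ⟨(i.2 _).2 le_rfl⟩, ?_⟩
      intro B (u : PLift (W B A))
      obtain ⟨s, hs⟩ := hW.left A ⟨B, u.down⟩
      refine ⟨⟨⟨s, hs⟩, homOfLE ((hs B).1 u.down)⟩, rfl, ?_⟩
      rintro ⟨⟨s', hs'⟩, f⟩ -
      obtain rfl : s' = s := le_antisymm ((hs' s).1 ((hs s).2 le_rfl))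
        ((hs s').1 ((hs' s').2 le_rfl))
      rfl
    · rw [Biset.rightRepresentable_iff]
      intro B
      refine ⟨{t // ∀ A, W B A ↔ A ≤ t}, Subtype.val, fun i => ⟨(i.2 _).2 le_rfl⟩, ?_⟩
      intro A (u : PLift (W B A))
      obtain ⟨s, hs⟩ := hW.right B ⟨A, u.down⟩
      refine ⟨⟨⟨s, hs⟩, homOfLE ((hs A).1 u.down)⟩, rfl, ?_⟩
      rintro ⟨⟨s', hs'⟩, f⟩ -
      obtain rfl : s' = s := le_antisymm ((hs s').1 ((hs' s').2 le_rfl))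
        ((hs' s).1 ((hs s).2 le_rfl))
      rfl⟩

instance (W : Set Y → Set X → Prop) (hW : IsThin W) (B : Set Y) (A : Set X) :
    Subsingleton ((thin W hW).1.El B A) := inferInstanceAs (Subsingleton (PLift (W B A)))

variable {R : Type u} [CommRing R]

theorem cls_eq_thin {Ω : BirepBiset (Set Y) (Set X)} {W : Set Y → Set X → Prop} (hW : IsThin W)
    (h : ∀ B A, Subsingleton (Ω.1.El B A)) (h' : ∀ B A, Nonempty (Ω.1.El B A) ↔ W B A) :
    BirepGrothendieck.cls R Ω = BirepGrothendieck.cls R (thin W hW) :=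
  BirepGrothendieck.cls_eq_of_iso ⟨Biset.isoMk (fun B A => Equiv.ofBijective
    (fun u => (⟨(h' B A).1 ⟨u⟩⟩ : PLift (W B A)))
    ⟨fun u v _ => (h B A).elim u v, fun w => ⟨((h' B A).2 w.down).some, rfl⟩⟩)
    (fun _ _ _ => rfl)⟩

/-- A thin relation is increasing in `B` and decreasing in `A`; failing at `(Set.univ, ∅)`, it fails
everywhere and the biset is empty. -/
theorem cls_thin_eq_zero {W : Set Y → Set X → Prop} (hW : IsThin W) (h : ¬ W Set.univ ∅) :
    BirepGrothendieck.cls R (thin W hW) = 0 := by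
  rw [← BirepGrothendieck.cls_empty]
  refine (cls_eq_thin hW ?_ ?_).symm
  · exact fun B A => inferInstanceAs (Subsingleton Empty)
  · intro B A
    constructor
    · rintro ⟨u⟩
      exact Empty.elim u
    · intro h'
      exact absurd (hW.anti_right (hW.mono_left h' (Set.subset_univ _)) (Set.empty_subset _)) h

/-- The composite biset has at most one element at each place: every representing pair can be slid
to the least middle subset `s` related to `A`, where both entries are unique. -/
theorem cls_thin_comp [Finite X] {W : Set Y → Set X → Prop} {W' : Set X → Set Z → Prop} (hW : IsThin W)
    (hW' : IsThin W') :
    BirepGrothendieck.comp (BirepGrothendieck.cls R (thin W hW))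
      (BirepGrothendieck.cls R (thin W' hW')) =
      BirepGrothendieck.cls R (thin _ (hW.comp hW')) := by
  rw [BirepGrothendieck.comp_cls]
  apply cls_eq_thin
  · intro C A
    refine ⟨fun a b => ?_⟩
    change Biset.CompEl (thin W hW).1 (thin W' hW').1 C A at a b
    have key : ∀ (s B : Set X) (hs : ∀ B, W' B A ↔ s ≤ B) (u : (thin W hW).1.El C B)
        (v : (thin W' hW').1.El B A), Biset.CompEl.mk u v =
          Biset.CompEl.mk ((thin W hW).1.act (𝟙 C) (homOfLE ((hs B).1 (PLift.down v))) u)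
            (⟨(hs s).2 le_rfl⟩ : PLift (W' s A)) := by
      intro s B hs u v
      exact (Biset.CompEl.sound (Ψ := (thin W' hW').1) u (homOfLE ((hs B).1 (PLift.down v)))
        (⟨(hs s).2 le_rfl⟩ : PLift (W' s A))).symm
    induction a using Biset.CompEl.ind with
    | h B u v =>
      induction b using Biset.CompEl.ind with
      | h B' u' v' =>
        obtain ⟨s, hs⟩ := hW'.left A ⟨B, PLift.down v⟩
        exact ((key s B hs u v).trans (congrArg (fun t => Biset.CompEl.mk t _)
          (Subsingleton.elim _ _))).trans (key s B' hs u' v').symm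
  · intro C A
    constructor
    · rintro ⟨a⟩
      change Biset.CompEl (thin W hW).1 (thin W' hW').1 C A at a
      induction a using Biset.CompEl.ind with
      | h B u v => exact ⟨B, PLift.down u, PLift.down v⟩
    · rintro ⟨B, h, h'⟩
      exact ⟨Biset.CompEl.mk (Ω := (thin W hW).1) (Ψ := (thin W' hW').1)
        (⟨h⟩ : PLift (W C B)) (⟨h'⟩ : PLift (W' B A))⟩

/-! ## Connected components -/

/-- The element of `Ω(Y, ∅)` labelling the component of an element. -/
def component (Ω : Biset (Set Y) (Set X)) {B : Set Y} {A : Set X} (u : Ω.El B A) :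
    Ω.El Set.univ ∅ :=
  Ω.act (homOfLE (Set.subset_univ B)) (homOfLE (Set.empty_subset A)) u

theorem component_act (Ω : Biset (Set Y) (Set X)) {B B' : Set Y} {A A' : Set X} (α : B ⟶ B')
    (β : A' ⟶ A) (u : Ω.El B A) : component Ω (Ω.act α β u) = component Ω u :=
  Ω.act_act _ _ _ _ _

theorem component_self (Ω : Biset (Set Y) (Set X)) (u : Ω.El Set.univ ∅) : component Ω u = u :=
  Ω.act_id u

/-- Since `∅` is initial, each summand `Hom(-, s i)` contributes its own element of `Ω(B, ∅)`. With
at most one such element there is at most one summand, and a representable functor on a poset is a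
principal down-set. -/
theorem right_of_subsingleton {Ω : Biset (Set Y) (Set X)} (hΩ : Ω.IsBirepresentable) {B : Set Y}
    (h : Subsingleton (Ω.El B ∅)) : (∀ A, Subsingleton (Ω.El B A)) ∧
      ((∃ A, Nonempty (Ω.El B A)) → ∃ t, ∀ A, Nonempty (Ω.El B A) ↔ A ≤ t) := by
  obtain ⟨I, s, g, hg⟩ := (Biset.rightRepresentable_iff Ω).1 hΩ.2 B
  have hI : ∀ i j : I, i = j := by
    intro i j
    obtain ⟨p, -, hp⟩ := hg ∅ (Ω.act (𝟙 B) (homOfLE (Set.empty_subset (s i))) (g i))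
    have h₁ := hp ⟨i, homOfLE (Set.empty_subset _)⟩ rfl
    have h₂ := hp ⟨j, homOfLE (Set.empty_subset _)⟩ (h.elim _ _)
    exact congrArg Sigma.fst (h₁.trans h₂.symm)
  refine ⟨fun A => ⟨fun u v => ?_⟩, ?_⟩
  · obtain ⟨⟨i, f⟩, rfl, -⟩ := hg A u
    obtain ⟨⟨j, f'⟩, rfl, -⟩ := hg A v
    obtain rfl := hI i j
    exact congrArg (fun f => Ω.act (𝟙 B) f (g i)) (Subsingleton.elim f f')
  · rintro ⟨A, ⟨u⟩⟩
    obtain ⟨⟨i, -⟩, -⟩ := hg A u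
    refine ⟨s i, fun A' => ⟨?_, fun hA => ⟨Ω.act (𝟙 B) (homOfLE hA) (g i)⟩⟩⟩
    rintro ⟨u'⟩
    obtain ⟨⟨j, f⟩, -⟩ := hg A' u'
    obtain rfl := hI i j
    exact leOfHom f

/-- Dual to `right_of_subsingleton`: the terminal object `Set.univ` counts the summands `Hom(s i,
-)`. -/
theorem left_of_subsingleton {Ω : Biset (Set Y) (Set X)} (hΩ : Ω.IsBirepresentable) {A : Set X}
    (h : Subsingleton (Ω.El Set.univ A)) : (∀ B, Subsingleton (Ω.El B A)) ∧
      ((∃ B, Nonempty (Ω.El B A)) → ∃ s, ∀ B, Nonempty (Ω.El B A) ↔ s ≤ B) := by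
  obtain ⟨I, s, g, hg⟩ := (Biset.leftRepresentable_iff Ω).1 hΩ.1 A
  have hI : ∀ i j : I, i = j := by
    intro i j
    obtain ⟨p, -, hp⟩ := hg Set.univ (Ω.act (homOfLE (Set.subset_univ (s i))) (𝟙 A) (g i))
    have h₁ := hp ⟨i, homOfLE (Set.subset_univ _)⟩ rfl
    have h₂ := hp ⟨j, homOfLE (Set.subset_univ _)⟩ (h.elim _ _)
    exact congrArg Sigma.fst (h₁.trans h₂.symm)
  refine ⟨fun B => ⟨fun u v => ?_⟩, ?_⟩
  · obtain ⟨⟨i, f⟩, rfl, -⟩ := hg B u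
    obtain ⟨⟨j, f'⟩, rfl, -⟩ := hg B v
    obtain rfl := hI i j
    exact congrArg (fun f => Ω.act f (𝟙 A) (g i)) (Subsingleton.elim f f')
  · rintro ⟨B, ⟨u⟩⟩
    obtain ⟨⟨i, -⟩, -⟩ := hg B u
    refine ⟨s i, fun B' => ⟨?_, fun hB => ⟨Ω.act (homOfLE hB) (𝟙 A) (g i)⟩⟩⟩
    rintro ⟨u'⟩
    obtain ⟨⟨j, f⟩, -⟩ := hg B' u'
    obtain rfl := hI i j
    exact leOfHom f

/-- A connected birepresentable biset is thin. -/
theorem exists_cls_eq_thin (Ω : BirepBiset (Set Y) (Set X))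
    (h : Subsingleton (Ω.1.El Set.univ ∅)) : ∃ (W : Set Y → Set X → Prop) (hW : IsThin W),
      BirepGrothendieck.cls R Ω = BirepGrothendieck.cls R (thin W hW) := by
  -- Thinness spreads from `(Set.univ, ∅)` along the row of `Set.univ`, from there to every column,
  -- and from the column of `∅` back to every row.
  have h₁ := (right_of_subsingleton Ω.2 h).1
  have h₂ := fun A => left_of_subsingleton Ω.2 (h₁ A)
  have h₃ := fun B => right_of_subsingleton Ω.2 ((h₂ ∅).1 B)
  exact ⟨fun B A => Nonempty (Ω.1.El B A), ⟨fun A => (h₂ A).2, fun B => (h₃ B).2⟩,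
    cls_eq_thin _ (fun B A => (h₂ A).1 B) (fun _ _ => Iff.rfl)⟩

/-- The union of some components of a biset. -/
def restrict (Ω : BirepBiset (Set Y) (Set X)) (p : Ω.1.El Set.univ ∅ → Prop) :
    BirepBiset (Set Y) (Set X) :=
  ⟨Biset.mk' (fun B A => {u : Ω.1.El B A // p (component Ω.1 u)})
    (fun α β u => ⟨Ω.1.act α β u.1, by rw [component_act]; exact u.2⟩)
    (fun u => Subtype.ext (Ω.1.act_id u.1))
    (fun α β α' β' u => Subtype.ext (Ω.1.act_act α β α' β' u.1).symm), by
    constructor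
    · rw [Biset.leftRepresentable_iff]
      intro A
      obtain ⟨I, s, g, hg⟩ := (Biset.leftRepresentable_iff Ω.1).1 Ω.2.1 A
      refine ⟨{i // p (component Ω.1 (g i))}, fun i => s i.1, fun i => ⟨g i.1, i.2⟩, ?_⟩
      rintro B ⟨u, hu⟩
      obtain ⟨⟨i, f⟩, rfl, hf⟩ := hg B u
      refine ⟨⟨⟨i, by rwa [component_act] at hu⟩, f⟩, rfl, ?_⟩
      rintro ⟨⟨j, hj⟩, f'⟩ h'
      have h₁ := hf ⟨j, f'⟩ (congrArg Subtype.val h')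
      cases h₁
      rfl
    · rw [Biset.rightRepresentable_iff]
      intro B
      obtain ⟨I, s, g, hg⟩ := (Biset.rightRepresentable_iff Ω.1).1 Ω.2.2 B
      refine ⟨{i // p (component Ω.1 (g i))}, fun i => s i.1, fun i => ⟨g i.1, i.2⟩, ?_⟩
      rintro A ⟨u, hu⟩
      obtain ⟨⟨i, f⟩, rfl, hf⟩ := hg A u
      refine ⟨⟨⟨i, by rwa [component_act] at hu⟩, f⟩, rfl, ?_⟩
      rintro ⟨⟨j, hj⟩, f'⟩ h'
      have h₁ := hf ⟨j, f'⟩ (congrArg Subtype.val h')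
      cases h₁
      rfl⟩

theorem cls_restrict_add (Ω : BirepBiset (Set Y) (Set X)) (p : Ω.1.El Set.univ ∅ → Prop) :
    BirepGrothendieck.cls R Ω = BirepGrothendieck.cls R (restrict Ω p) +
      BirepGrothendieck.cls R (restrict Ω fun u => ¬ p u) := by
  classical
  refine BirepGrothendieck.cls_disjUnion ⟨Iso.symm (Biset.isoMk
    (fun B A => Equiv.sumCompl (fun u : Ω.1.El B A => p (component Ω.1 u))) ?_)⟩
  rintro B B' A A' α β (u | u) <;> rfl

theorem card_restrict_lt (Ω : BirepBiset (Set Y) (Set X)) (p : Ω.1.El Set.univ ∅ → Prop)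
    (u : Ω.1.El Set.univ ∅) (hu : ¬ p u) :
    Nat.card ((restrict Ω p).1.El Set.univ ∅) < Nat.card (Ω.1.El Set.univ ∅) := by
  have h : Nat.card ((restrict Ω p).1.El Set.univ ∅) =
      Nat.card {u : Ω.1.El Set.univ ∅ // p (component Ω.1 u)} := rfl
  rw [h]
  refine Finite.card_subtype_lt (x := u) ?_
  rwa [component_self]

/-- The classes of the thin bisets span. -/
theorem cls_mem_span_thin (Ω : BirepBiset (Set Y) (Set X)) :
    BirepGrothendieck.cls R Ω ∈ Submodule.span R
      {a | ∃ (W : Set Y → Set X → Prop) (hW : IsThin W), a = BirepGrothendieck.cls R (thin W hW)} := by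
  induction hn : Nat.card (Ω.1.El Set.univ ∅) using Nat.strong_induction_on generalizing Ω with
  | h n ih =>
    subst hn
    by_cases h : Subsingleton (Ω.1.El Set.univ ∅)
    · obtain ⟨W, hW, h'⟩ := exists_cls_eq_thin (R := R) Ω h
      exact Submodule.subset_span ⟨W, hW, h'⟩
    · rw [not_subsingleton_iff_nontrivial] at h
      obtain ⟨u, v, huv⟩ := h
      -- Split off the component of `u`. One part misses `v` and the other misses `u`, so both have
      -- fewer components.
      rw [cls_restrict_add Ω (fun w => w = u)]
      have h₁ := card_restrict_lt Ω (fun w => w = u) v huv.symm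
      have h₂ := card_restrict_lt Ω (fun w => ¬ w = u) u (not_not.2 rfl)
      exact add_mem (ih _ h₁ _ rfl) (ih _ h₂ _ rfl)

theorem mem_span_thin (a : BirepGrothendieck R (Set Y) (Set X)) : a ∈ Submodule.span R
      {a | ∃ (W : Set Y → Set X → Prop) (hW : IsThin W), a = BirepGrothendieck.cls R (thin W hW)} := by
  induction a using BirepGrothendieck.induction with
  | hcls Ω => exact cls_mem_span_thin Ω
  | hadd a b ha hb => exact add_mem ha hb
  | hsmul r a ha => exact Submodule.smul_mem _ r ha

end ThinBiset

namespace ThinBiset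

/-! ## Thin relations attached to correspondences -/

section Relations

variable {X Y Z : Corresp}

theorem isThin_image (U : X ⟶ Y) : IsThin fun B A => Corresp.image U A ≤ B where
  left A _ := ⟨Corresp.image U A, fun _ => Iff.rfl⟩
  right B _ := ⟨_, fun A => Corresp.gc_image U A B⟩

theorem cls_biset (R : Type u) [CommRing R] (U : X ⟶ Y) :
    BirepGrothendieck.cls R (Corresp.biset U) =
      BirepGrothendieck.cls R (thin _ (isThin_image U)) :=
  cls_eq_thin _ (fun B A => inferInstanceAs (Subsingleton (Corresp.image U A ⟶ B)))
    (fun _ _ => ⟨fun ⟨f⟩ => leOfHom f, fun h => ⟨homOfLE h⟩⟩)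

theorem image_injective {U V : X ⟶ Y}
    (h : ∀ B A, Corresp.image U A ≤ B ↔ Corresp.image V A ≤ B) : U = V := by
  have h₁ : ∀ A, Corresp.image U A = Corresp.image V A :=
    fun A => le_antisymm ((h _ A).2 le_rfl) ((h _ A).1 le_rfl)
  apply Corresp.Hom.ext
  ext ⟨y, x⟩
  have h₂ := Set.ext_iff.1 (h₁ {x}) y
  simpa [Corresp.image] using h₂

/-- A thin relation that is defined everywhere and relates the empty sets comes from a
correspondence. -/
theorem IsThin.exists_corresp {W : Set Y.carrier → Set X.carrier → Prop} (hW : IsThin W)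
    (h₀ : W ∅ ∅) (h₁ : W Set.univ Set.univ) :
    ∃ U : X ⟶ Y, ∀ B A, W B A ↔ Corresp.image U A ≤ B := by
  refine ⟨⟨{p | ∀ B, W B {p.2} → p.1 ∈ B}⟩, fun B A => ⟨?_, fun h => ?_⟩⟩
  · rintro h y ⟨x, hx, hy⟩
    exact hy B (hW.anti_right h (Set.singleton_subset_iff.2 hx))
  -- The row of `B` is nonempty by `h₀`, hence a principal down-set, so `W B A` can be tested on the
  -- singletons `{x}` with `x ∈ A`. On these, the fibre of the correspondence is the least subset
  -- related to `{x}`, which exists by `h₁`.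
  · obtain ⟨t, ht⟩ := hW.right B ⟨∅, hW.mono_left h₀ (Set.empty_subset B)⟩
    rw [ht]
    intro x hx
    obtain ⟨s, hs⟩ := hW.left {x} ⟨Set.univ, hW.anti_right h₁ (Set.subset_univ _)⟩
    apply (ht {x}).1 _ rfl
    rw [hs]
    exact fun y hy => h ⟨x, hx, fun B' hB' => (hs B').1 hB' hy⟩

/-- If the composite of two thin relations comes from a correspondence, then this correspondence
factors in the same way. -/
theorem exists_factorization {W : Set Z.carrier → Set Y.carrier → Prop}
    {W' : Set Y.carrier → Set X.carrier → Prop} (hW : IsThin W) (hW' : IsThin W') {U : X ⟶ Z}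
    (hU : ∀ C A, (∃ B, W C B ∧ W' B A) ↔ Corresp.image U A ≤ C) :
    ∃ (h : X ⟶ Y) (g : Y ⟶ Z), U = h ≫ g := by
  -- Each relation is replaced by its least values on singletons. Where `W` relates nothing to `{y}`
  -- the condition is vacuous, so `y` is then matched with every `z`.
  refine ⟨⟨{p | ∀ B, W' B {p.2} → p.1 ∈ B}⟩, ⟨{p | ∀ C, W C {p.2} → p.1 ∈ C}⟩, ?_⟩
  obtain ⟨B₀, h₀, -⟩ := (hU ∅ ∅).2 (by rintro y ⟨x, hx, -⟩; exact hx)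
  have h₀₀ : W ∅ ∅ := hW.anti_right h₀ (Set.empty_subset _)
  apply Corresp.Hom.ext
  ext ⟨z, x⟩
  change _ ↔ ∃ y, (∀ C, W C {y} → z ∈ C) ∧ (∀ B, W' B {x} → y ∈ B)
  obtain ⟨B₁, -, h₁'⟩ := (hU Set.univ {x}).2 (Set.subset_univ _)
  obtain ⟨s, hs⟩ := hW'.left {x} ⟨B₁, h₁'⟩
  have hUx : ∀ C, Corresp.image U {x} ≤ C ↔ W C s := by
    intro C
    rw [← hU]
    refine ⟨?_, fun h => ⟨s, h, (hs s).2 le_rfl⟩⟩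
    rintro ⟨B, h, h'⟩
    exact hW.anti_right h ((hs B).1 h')
  have hmem : (z, x) ∈ U.rel ↔ ∀ C, W C s → z ∈ C := by
    have h₂ : (z, x) ∈ U.rel ↔ z ∈ Corresp.image U {x} := by simp [Corresp.image]
    rw [h₂]
    exact ⟨fun h C hC => (hUx C).2 hC h, fun h => h _ ((hUx _).1 le_rfl)⟩
  rw [hmem]
  constructor
  · intro h
    by_contra! hcon
    have h₂ : ∀ y ∈ s, ∃ C, W C {y} ∧ z ∉ C := by
      intro y hy
      by_contra! h₃
      obtain ⟨B, hB, hyB⟩ := hcon y h₃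
      exact hyB ((hs B).1 hB hy)
    choose! c hc hc' using h₂
    -- The union is related to every `{y}` with `y ∈ s`, hence to `s`, because its row is a
    -- principal down-set. Yet it avoids `z`, although `z` lies in every subset that `W` relates to
    -- `s`.
    have h₃ : W (⋃ y ∈ s, c y) s := by
      obtain ⟨t, ht⟩ := hW.right (⋃ y ∈ s, c y) ⟨∅, hW.mono_left h₀₀ (Set.empty_subset _)⟩
      rw [ht]
      intro y hy
      exact (ht {y}).1 (hW.mono_left (hc y hy) (Set.subset_biUnion_of_mem hy)) rfl
    have h₄ := h _ h₃
    simp only [Set.mem_iUnion] at h₄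
    obtain ⟨y, hy, hz⟩ := h₄
    exact hc' y hy hz
  · rintro ⟨y, hy, hy'⟩ C hC
    exact hy C (hW.anti_right hC (Set.singleton_subset_iff.2 (hy' s ((hs s).2 le_rfl))))

/-- A thin relation that is not defined everywhere factors through a smaller set. -/
theorem IsThin.factor_right {W : Set Y.carrier → Set X.carrier → Prop} (hW : IsThin W)
    {T : Set X.carrier} (hT : ∀ A, W Set.univ A → A ⊆ T) :
    ∃ (W₁ : Set Y.carrier → Set T → Prop) (W₂ : Set T → Set X.carrier → Prop),
      IsThin W₁ ∧ IsThin W₂ ∧ ∀ B A, (∃ C, W₁ B C ∧ W₂ C A) ↔ W B A := by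
  -- The second factor is the partial identity, defined exactly on the subsets of `T`; the first is
  -- `W` on these subsets.
  refine ⟨fun B C => W B (Subtype.val '' C), fun C A => A ⊆ Subtype.val '' C,
    ⟨fun C h => hW.left _ h, ?_⟩, ⟨?_, fun C _ => ⟨_, fun A => Iff.rfl⟩⟩, fun B A => ⟨?_, ?_⟩⟩
  · rintro B ⟨C, h⟩
    obtain ⟨t, ht⟩ := hW.right B ⟨_, h⟩
    exact ⟨Subtype.val ⁻¹' t, fun C' => (ht _).trans Set.image_subset_iff⟩
  · rintro A ⟨C, h⟩
    refine ⟨Subtype.val ⁻¹' A, fun C' => ⟨?_, fun h' x hx => ?_⟩⟩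
    · rintro h' ⟨x, hxT⟩ hx
      obtain ⟨y, hy, rfl⟩ := h' hx
      exact hy
    · obtain ⟨y, -, rfl⟩ := h hx
      exact ⟨y, h' hx, rfl⟩
  · rintro ⟨C, h, h'⟩
    exact hW.anti_right h h'
  · intro h
    have hA : A ⊆ T := hT A (hW.mono_left h (Set.subset_univ _))
    have h₁ : Subtype.val '' (Subtype.val ⁻¹' A : Set T) = A := by
      rw [Subtype.image_preimage_coe]
      exact Set.inter_eq_right.2 hA
    exact ⟨Subtype.val ⁻¹' A, (congrArg (fun C => W B C) h₁).mpr h, h₁.ge⟩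

/-- A thin relation whose values all contain a common subset factors through its complement. -/
theorem IsThin.factor_left {W : Set Y.carrier → Set X.carrier → Prop} (hW : IsThin W)
    {S : Set Y.carrier} (hS : ∀ B, W B ∅ → S ⊆ B) :
    ∃ (W₁ : Set Y.carrier → Set ↥Sᶜ → Prop) (W₂ : Set ↥Sᶜ → Set X.carrier → Prop),
      IsThin W₁ ∧ IsThin W₂ ∧ ∀ B A, (∃ C, W₁ B C ∧ W₂ C A) ↔ W B A := by
  -- The second factor removes the common part `S` from the least value of `W`, and the first adds
  -- it back.
  refine ⟨fun B C => S ∪ Subtype.val '' C ⊆ B, fun C A => W (S ∪ Subtype.val '' C) A,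
    ⟨fun C _ => ⟨_, fun B => Iff.rfl⟩, ?_⟩, ⟨?_, fun C h => hW.right _ h⟩, fun B A => ⟨?_, ?_⟩⟩
  · rintro B ⟨C, h⟩
    refine ⟨Subtype.val ⁻¹' B, fun C' => ?_⟩
    rw [Set.union_subset_iff, Set.image_subset_iff]
    exact and_iff_right (Set.subset_union_left.trans h)
  · rintro A ⟨C, h⟩
    obtain ⟨s, hs⟩ := hW.left A ⟨_, h⟩
    refine ⟨Subtype.val ⁻¹' s, fun C' => (hs _).trans ⟨?_, ?_⟩⟩
    · rintro h' ⟨y, hyS⟩ hy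
      rcases h' hy with h₁ | ⟨y', hy', rfl⟩
      · exact absurd h₁ hyS
      · exact hy'
    · intro h' y hy
      by_cases hyS : y ∈ S
      · exact Or.inl hyS
      · exact Or.inr ⟨⟨y, hyS⟩, h' hy, rfl⟩
  · rintro ⟨C, h, h'⟩
    exact hW.mono_left h' h
  · intro h
    have hB : S ⊆ B := hS B (hW.anti_right h (Set.empty_subset _))
    have h₁ : S ∪ Subtype.val '' (Subtype.val ⁻¹' B : Set ↥Sᶜ) = B := by
      rw [Subtype.image_preimage_coe]
      ext y
      by_cases hy : y ∈ S
      · simp [hy, hB hy]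
      · simp [hy]
    exact ⟨Subtype.val ⁻¹' B, h₁.le, (congrArg (fun C => W C A) h₁).mpr h⟩

end Relations

/-! ## The projection onto the algebra of correspondences -/

section Projection

variable {R : Type u} [CommRing R] {X : Corresp}

open Classical in
/-- The correspondence attached to a relation, or zero if there is none. -/
noncomputable def correspOf (R : Type u) [CommRing R]
    (W : Set X.carrier → Set X.carrier → Prop) : (X ⟶ X) →₀ R :=
  if h : ∃ U : X ⟶ X, ∀ B A, W B A ↔ Corresp.image U A ≤ B then Finsupp.single h.choose 1 else 0

theorem correspOf_eq_single {W : Set X.carrier → Set X.carrier → Prop} {U : X ⟶ X}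
    (h : ∀ B A, W B A ↔ Corresp.image U A ≤ B) : correspOf R W = Finsupp.single U 1 := by
  have h' : ∃ U : X ⟶ X, ∀ B A, W B A ↔ Corresp.image U A ≤ B := ⟨U, h⟩
  rw [correspOf, dif_pos h',
    image_injective fun B A => (h'.choose_spec B A).symm.trans (h B A)]

/-- The subsets related by a component of a biset. -/
def support (Ω : Biset (Set X.carrier) (Set X.carrier)) (u : Ω.El Set.univ ∅)
    (B A : Set X.carrier) : Prop :=
  ∃ w : Ω.El B A, component Ω w = u

/-- The sum of the correspondences attached to the components of a biset. -/
noncomputable def correspSum (R : Type u) [CommRing R]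
    (Ω : Biset (Set X.carrier) (Set X.carrier)) : (X ⟶ X) →₀ R :=
  ∑ᶠ u : Ω.El Set.univ ∅, correspOf R (support Ω u)

/-- The components of a disjoint union are those of the two summands, with unchanged supports. This
additivity lets the sum descend to the Grothendieck group. -/
theorem correspSum_disjUnion {Ω Ω₁ Ω₂ : Biset (Set X.carrier) (Set X.carrier)}
    (i : Ω ≅ Biset.disjUnion Ω₁ Ω₂) : correspSum R Ω = correspSum R Ω₁ + correspSum R Ω₂ := by
  let e : Ω.El Set.univ ∅ ≃ Ω₁.El Set.univ ∅ ⊕ Ω₂.El Set.univ ∅ := Biset.isoEquiv i Set.univ ∅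
  have hsupp : ∀ u B A, support Ω u B A ↔
      support (Biset.disjUnion Ω₁ Ω₂) (e u : (Biset.disjUnion Ω₁ Ω₂).El Set.univ ∅) B A := by
    intro u B A
    constructor
    · rintro ⟨w, rfl⟩
      exact ⟨Biset.isoEquiv i B A w, (Biset.isoEquiv_act i _ _ w).symm⟩
    · rintro ⟨w, hw⟩
      obtain ⟨w, rfl⟩ := (Biset.isoEquiv i B A).surjective w
      exact ⟨w, e.injective ((Biset.isoEquiv_act i _ _ w).trans hw)⟩
  have h₁ : ∀ u : Ω₁.El Set.univ ∅,
      support (Biset.disjUnion Ω₁ Ω₂) (Sum.inl u : Ω₁.El Set.univ ∅ ⊕ Ω₂.El Set.univ ∅) =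
        support Ω₁ u := by
    intro u
    ext B A
    constructor
    · rintro ⟨w | w, hw⟩
      · exact ⟨w, Sum.inl_injective hw⟩
      · cases hw
    · rintro ⟨w, rfl⟩
      exact ⟨(Sum.inl w : Ω₁.El B A ⊕ Ω₂.El B A), rfl⟩
  have h₂ : ∀ u : Ω₂.El Set.univ ∅,
      support (Biset.disjUnion Ω₁ Ω₂) (Sum.inr u : Ω₁.El Set.univ ∅ ⊕ Ω₂.El Set.univ ∅) =
        support Ω₂ u := by
    intro u
    ext B A
    constructor
    · rintro ⟨w | w, hw⟩
      · cases hw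
      · exact ⟨w, Sum.inr_injective hw⟩
    · rintro ⟨w, rfl⟩
      exact ⟨(Sum.inr w : Ω₁.El B A ⊕ Ω₂.El B A), rfl⟩
  let _ := Fintype.ofFinite (Ω.El Set.univ ∅)
  let _ := Fintype.ofFinite (Ω₁.El Set.univ ∅)
  let _ := Fintype.ofFinite (Ω₂.El Set.univ ∅)
  rw [correspSum, correspSum, correspSum, finsum_eq_sum_of_fintype, finsum_eq_sum_of_fintype,
    finsum_eq_sum_of_fintype]
  refine (Fintype.sum_equiv e _ (fun u => correspOf R
    (support (Biset.disjUnion Ω₁ Ω₂) (u : (Biset.disjUnion Ω₁ Ω₂).El Set.univ ∅))) ?_).trans ?_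
  · intro u
    congr 1
    ext B A
    exact hsupp u B A
  · rw [Fintype.sum_sum_type]
    exact congrArg₂ (· + ·) (Finset.sum_congr rfl fun u _ => congrArg _ (h₁ u))
      (Finset.sum_congr rfl fun u _ => congrArg _ (h₂ u))

/-- There is one component, with support `W`, if `W` holds at `(Set.univ, ∅)`. Otherwise there is
none, and `W` is no correspondence, as the relation of a correspondence always holds there. -/
theorem correspSum_thin {W : Set X.carrier → Set X.carrier → Prop} (hW : IsThin W) :
    correspSum R (thin W hW).1 = correspOf R W := by
  by_cases h : W Set.univ ∅
  · let u₀ : (thin W hW).1.El Set.univ ∅ := (⟨h⟩ : PLift (W Set.univ ∅))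
    rw [correspSum, finsum_eq_single _ u₀ fun u hu => absurd (Subsingleton.elim _ _) hu]
    congr 1
    ext B A
    constructor
    · rintro ⟨w, -⟩
      exact PLift.down w
    · intro h'
      exact ⟨(⟨h'⟩ : PLift (W B A)), Subsingleton.elim _ _⟩
  · have : IsEmpty ((thin W hW).1.El Set.univ ∅) := ⟨fun u => h (PLift.down u)⟩
    have h' : ¬ ∃ U : X ⟶ X, ∀ B A, W B A ↔ Corresp.image U A ≤ B := by
      rintro ⟨U, hU⟩
      exact h ((hU _ _).2 (Set.subset_univ _))
    rw [correspSum, finsum_of_isEmpty, correspOf, dif_neg h']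

variable (R X) in
/-- The projection from endomorphisms of `2^X` to combinations of correspondences. -/
noncomputable def projection :
    BirepGrothendieck R (Set X.carrier) (Set X.carrier) →ₗ[R] ((X ⟶ X) →₀ R) :=
  BirepGrothendieck.lift (fun Ω => correspSum R Ω.1) fun _ _ _ ⟨i⟩ => correspSum_disjUnion i

theorem projection_thin {W : Set X.carrier → Set X.carrier → Prop} (hW : IsThin W) :
    projection R X (BirepGrothendieck.cls R (thin W hW)) = correspOf R W :=
  (BirepGrothendieck.lift_cls _ _ _).trans (correspSum_thin hW)

end Projection

/-! ## Reduction of the biset category to correspondences -/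

section Reduction

open ModuleFunctor

variable (R : Type u) [CommRing R]

/-- The elements of the Grothendieck group as endomorphisms in the biset category. -/
def toEnd (X : Corresp) : BirepGrothendieck R (Set X.carrier) (Set X.carrier) →ₗ[R]
    ((Corresp.toBiset R).obj X ⟶ (Corresp.toBiset R).obj X) where
  toFun f := f
  map_add' _ _ := rfl
  map_smul' _ _ := rfl

theorem mem_smallEnd_of_factor {X Z : Corresp} (hZ : Nat.card Z.carrier < Nat.card X.carrier)
    {W : Set X.carrier → Set X.carrier → Prop} (hW : IsThin W)
    {W₁ : Set X.carrier → Set Z.carrier → Prop} {W₂ : Set Z.carrier → Set X.carrier → Prop}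
    (h₁ : IsThin W₁) (h₂ : IsThin W₂) (h : ∀ B A, (∃ C, W₁ B C ∧ W₂ C A) ↔ W B A) :
    toEnd R X (BirepGrothendieck.cls R (thin W hW)) ∈ smallEnd R (Corresp.toBiset R) X := by
  refine Submodule.subset_span ⟨Z, hZ, BirepGrothendieck.cls R (thin W₂ h₂),
    BirepGrothendieck.cls R (thin W₁ h₁), ?_⟩
  refine Eq.trans ?_ (cls_thin_comp h₁ h₂).symm
  obtain rfl : (fun B A => ∃ C, W₁ B C ∧ W₂ C A) = W := by
    ext B A
    exact h B A
  rfl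

/-- Let `T` be the largest subset at which `W` is defined and `S` its least value at `∅`. If `T` is
everything and `S` is empty, `W` is a correspondence. A proper `T` gives a factorization through
`2^T`, a nonempty `S` one through the subsets of its complement, and a `W` defined nowhere has class
zero. -/
theorem thin_mem_smallEnd {X : Corresp} {W : Set X.carrier → Set X.carrier → Prop}
    (hW : IsThin W) (h : ¬ ∃ U : X ⟶ X, ∀ B A, W B A ↔ Corresp.image U A ≤ B) :
    toEnd R X (BirepGrothendieck.cls R (thin W hW)) ∈ smallEnd R (Corresp.toBiset R) X := by
  by_cases h₀ : W Set.univ ∅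
  · obtain ⟨T, hT⟩ := hW.right Set.univ ⟨∅, h₀⟩
    obtain ⟨S, hS⟩ := hW.left ∅ ⟨Set.univ, h₀⟩
    by_cases hT' : T = Set.univ
    · by_cases hS' : S = ∅
      · exact absurd (hW.exists_corresp ((hS ∅).2 hS'.le) ((hT Set.univ).2 hT'.ge)) h
      · obtain ⟨W₁, W₂, h₁, h₂, h₃⟩ := hW.factor_left (fun B => (hS B).1)
        refine mem_smallEnd_of_factor R (Z := ⟨↥Sᶜ⟩) ?_ hW h₁ h₂ h₃
        obtain ⟨y, hy⟩ := Set.nonempty_iff_ne_empty.2 hS'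
        exact Finite.card_subtype_lt (x := y) (fun h => h hy)
    · obtain ⟨W₁, W₂, h₁, h₂, h₃⟩ := hW.factor_right (fun B => (hT B).1)
      refine mem_smallEnd_of_factor R (Z := ⟨T⟩) ?_ hW h₁ h₂ h₃
      obtain ⟨x, hx⟩ := (Set.ne_univ_iff_exists_notMem T).1 hT'
      exact Finite.card_subtype_lt (x := x) hx
  · have h' : BirepGrothendieck.cls R (thin W hW) = 0 := cls_thin_eq_zero hW h₀
    rw [h', map_zero]
    exact zero_mem _

/-- By bilinearity both factors may be taken thin. Their composite is thin and projects to zero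
unless it is a correspondence, which then factors through `Z` by `exists_factorization`. -/
theorem projection_comp_mem {X Z : Corresp} (hZ : Nat.card Z.carrier < Nat.card X.carrier)
    (h : BirepGrothendieck R (Set Z.carrier) (Set X.carrier))
    (g : BirepGrothendieck R (Set X.carrier) (Set Z.carrier)) :
    projection R X (BirepGrothendieck.comp g h) ∈ smallCorresp R X := by
  have hg := mem_span_thin g
  have hh := mem_span_thin h
  induction hg using Submodule.span_induction with
  | zero => simp
  | add a b _ _ ha hb =>
    rw [map_add, LinearMap.add_apply, map_add]
    exact add_mem ha hb
  | smul r a _ ha =>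
    rw [map_smul, LinearMap.smul_apply, map_smul]
    exact Submodule.smul_mem _ r ha
  | mem g hg =>
    obtain ⟨W, hW, rfl⟩ := hg
    induction hh using Submodule.span_induction with
    | zero => simp
    | add a b _ _ ha hb =>
      rw [map_add, map_add]
      exact add_mem ha hb
    | smul r a _ ha =>
      rw [map_smul, map_smul]
      exact Submodule.smul_mem _ r ha
    | mem h hh =>
      obtain ⟨W', hW', rfl⟩ := hh
      rw [cls_thin_comp, projection_thin]
      by_cases hU : ∃ U : X ⟶ X, ∀ C A, (∃ B, W C B ∧ W' B A) ↔ Corresp.image U A ≤ C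
      · obtain ⟨U, hU⟩ := hU
        rw [correspOf_eq_single hU]
        obtain ⟨a, b, rfl⟩ := exists_factorization hW hW' hU
        exact Submodule.subset_span ⟨Z, hZ, a, b, rfl⟩
      · rw [correspOf, dif_neg hU]
        exact zero_mem _

theorem reducesToCorresp_toBiset : ReducesToCorresp R (Corresp.toBiset R) := by
  intro X
  refine ⟨projection R X, ?_, ?_, ?_⟩
  · intro U
    change projection R X (BirepGrothendieck.cls R (Corresp.biset U)) = _
    rw [cls_biset, projection_thin]
    exact correspOf_eq_single fun _ _ => Iff.rfl
  · intro f
    -- The difference is linear in `f`, so thin generators suffice: it vanishes on correspondences,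
    -- and on any other thin biset it is the class itself.
    let D := toEnd R X - linearExtension R (Corresp.toBiset R) X ∘ₗ projection R X
    have hD : Submodule.span R {a | ∃ (W : Set X.carrier → Set X.carrier → Prop) (hW : IsThin W),
        a = BirepGrothendieck.cls R (thin W hW)} ≤
          (smallEnd R (Corresp.toBiset R) X).comap D := by
      refine Submodule.span_le.2 ?_
      rintro _ ⟨W, hW, rfl⟩
      change toEnd R X (BirepGrothendieck.cls R (thin W hW)) -
        linearExtension R (Corresp.toBiset R) X
          (projection R X (BirepGrothendieck.cls R (thin W hW))) ∈
            smallEnd R (Corresp.toBiset R) X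
      rw [projection_thin]
      by_cases hU : ∃ U : X ⟶ X, ∀ B A, W B A ↔ Corresp.image U A ≤ B
      · obtain ⟨U, hU⟩ := hU
        obtain rfl : W = fun B A => Corresp.image U A ≤ B := by
          ext B A
          exact hU B A
        have h₁ : (Corresp.toBiset R).map U =
            toEnd R X (BirepGrothendieck.cls R (thin _ hW)) := cls_biset R U
        rw [correspOf_eq_single hU, linearExtension, Finsupp.linearCombination_single, one_smul,
          h₁, sub_self]
        exact zero_mem _
      · rw [correspOf, dif_neg hU, map_zero, sub_zero]
        exact thin_mem_smallEnd R hW hU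
    exact hD (mem_span_thin (R := R) (X := X.carrier) (Y := X.carrier) f)
  · intro f hf
    have h : smallEnd R (Corresp.toBiset R) X ≤ (smallCorresp R X).comap (projection R X) := by
      refine Submodule.span_le.2 ?_
      rintro _ ⟨Z, hZ, h, g, rfl⟩
      exact projection_comp_mem R hZ h g
    exact h hf

/-- The subcategory is full and contains every `2^Z`, so it has the same endomorphisms of `2^X` and
the same ideal of morphisms through smaller sets. The same projection works. -/
theorem reducesToCorresp_toBoolean : ReducesToCorresp R (Corresp.toBoolean R) := by
  intro X
  obtain ⟨θ, h₁, h₂, h₃⟩ := reducesToCorresp_toBiset R X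
  let a : ((Corresp.toBoolean R).obj X ⟶ (Corresp.toBoolean R).obj X) →ₗ[R]
      ((Corresp.toBiset R).obj X ⟶ (Corresp.toBiset R).obj X) :=
    { toFun f := f.hom
      map_add' _ _ := rfl
      map_smul' _ _ := rfl }
  let b : ((Corresp.toBiset R).obj X ⟶ (Corresp.toBiset R).obj X) →ₗ[R]
      ((Corresp.toBoolean R).obj X ⟶ (Corresp.toBoolean R).obj X) :=
    { toFun f := ObjectProperty.homMk f
      map_add' _ _ := rfl
      map_smul' _ _ := rfl }
  have ha : smallEnd R (Corresp.toBoolean R) X ≤ (smallEnd R (Corresp.toBiset R) X).comap a := by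
    refine Submodule.span_le.2 ?_
    rintro _ ⟨Z, hZ, h, g, rfl⟩
    exact Submodule.subset_span ⟨Z, hZ, h.hom, g.hom, rfl⟩
  have hb : smallEnd R (Corresp.toBiset R) X ≤ (smallEnd R (Corresp.toBoolean R) X).comap b := by
    refine Submodule.span_le.2 ?_
    rintro _ ⟨Z, hZ, h, g, rfl⟩
    exact Submodule.subset_span ⟨Z, hZ, ObjectProperty.homMk h, ObjectProperty.homMk g, rfl⟩
  have hlin : ∀ c, b (linearExtension R (Corresp.toBiset R) X c) =
      linearExtension R (Corresp.toBoolean R) X c := by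
    intro c
    simp only [linearExtension, Finsupp.linearCombination_apply, Finsupp.sum, map_sum, map_smul]
    rfl
  refine ⟨θ ∘ₗ a, fun U => h₁ U, fun f => ?_, fun f hf => h₃ _ (ha hf)⟩
  have h := hb (h₂ (a f))
  rw [Submodule.mem_comap, map_sub, hlin] at h
  exact h

end Reduction

end ThinBiset

theorem mainTheorem6 (R : Type u) [CommRing R] :
    -- functors on the biset category of all finite categories
    ((∀ S, simpleNonvanishing R (Corresp.toBiset R) S →
        (∃ X, IsMinimalSet (Corresp.toBiset R ⋙ S) X) ∧
        ∀ X, IsMinimalSet (Corresp.toBiset R ⋙ S) X →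
          ∃ T, IsUniqueFactorAt (Corresp.toBiset R ⋙ S) T X ∧
            SameEvaluation (Corresp.toBiset R ⋙ S) T X) ∧
      ∃ Φ : IsoClasses (simpleNonvanishing R (Corresp.toBiset R)) ≃ IsoClasses (simpleCorresp R),
        ∀ (S : (simpleNonvanishing R (Corresp.toBiset R)).FullSubcategory)
          (T : (simpleCorresp R).FullSubcategory) (X : Corresp),
          IsMinimalSet (Corresp.toBiset R ⋙ S.obj) X →
            (Φ (isoClass S) = isoClass T ↔ IsFactorAt (Corresp.toBiset R ⋙ S.obj) T.obj X)) ∧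
    -- functors on the full subcategory of the posets of subsets of finite sets
    ((∀ S, simpleNonvanishing R (Corresp.toBoolean R) S →
        (∃ X, IsMinimalSet (Corresp.toBoolean R ⋙ S) X) ∧
        ∀ X, IsMinimalSet (Corresp.toBoolean R ⋙ S) X →
          ∃ T, IsUniqueFactorAt (Corresp.toBoolean R ⋙ S) T X ∧
            SameEvaluation (Corresp.toBoolean R ⋙ S) T X) ∧
      ∃ Φ : IsoClasses (simpleNonvanishing R (Corresp.toBoolean R)) ≃ IsoClasses (simpleCorresp R),
        ∀ (S : (simpleNonvanishing R (Corresp.toBoolean R)).FullSubcategory)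
          (T : (simpleCorresp R).FullSubcategory) (X : Corresp),
          IsMinimalSet (Corresp.toBoolean R ⋙ S.obj) X →
            (Φ (isoClass S) = isoClass T ↔ IsFactorAt (Corresp.toBoolean R ⋙ S.obj) T.obj X)) :=
  ⟨(ThinBiset.reducesToCorresp_toBiset R).main, (ThinBiset.reducesToCorresp_toBoolean R).main⟩
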